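/- Let $\mathbb T=\mathbb R/\mathbb Z$ and let $W\in C^2([0,\infty),[0,\infty))$ (one-sided derivatives at $0$). Let $W^{**}$ be its convex envelope on $[0,\infty)$, put $Q'(y)=yW'(y)-W(y)$ and $\Sigma=\overline{\{W>W^{**}\}\cup\{0\}}$. Assume: * (H1) there is a constant $c>0$ with $|Q'(y)|\le c(1+W(y))$ and $|W'(y)|\le c(1+W(y))$ for all $y\ge 0$; * (H2) $\lim_{y\to+\infty}Q'(y)=+\infty$; * (H3) $\Sigma=\bigcup_{i=1}^p[a_i,b_i]$ with $p\in\mathbb N$, $a_i\le b_i<a_{i+1}$; * (H4) $W''(y)>0$ for all $y\in[0,\infty)\setminus\Sigma$. For $\varepsilon>0$ and a probability density $\mu$ on $\mathbb T$ set $$E^\varepsilon[\mu]=\int_{\mathbb T}\tfrac{\varepsilon^2}{2}|\mu_x|^2+W(\mu)\,dx\ \text{ if }\mu\in H^1(\mathbb T),\qquad E^\varepsilon[\mu]=+\infty\ \text{ otherwise.}$$ For $\mu\in H^1(\mathbb T)$ let $G^\varepsilon(\mu)=\mu W'(\mu)-W(\mu)+\frac{3\varepsilon^2}{2}|\mu_x|^2-\varepsilon^2(\mu\mu_x)_x$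 in the sense of distributions on $\mathbb T$, and $$\mathcal G^\varepsilon(\mu)=\inf\{\|g\|_{L^2(\mathbb T)}: g\in L^2(\mathbb T),\ G^\varepsilon(\mu)_x=\sqrt{\mu}\,g \text{ in the sense of distributions}\},$$ with $\inf\varnothing=+\infty$; set $\mathcal G^\varepsilon(\mu)=+\infty$ if $\mu\notin H^1(\mathbb T)$. **Theorem 4.1.** For every $C\ge 0$ and $\eta>0$ there is $\delta=\delta(\eta,C)>0$ such that for every $L\ge 0$ there is $\varepsilon_0=\varepsilon_0(\eta,C,L)>0$ with the following property. Let $\{\rho^\varepsilon\}_{\varepsilon\in I}$, $I\subseteq(0,\infty)$, be a family of probability densities of class $C^1$ on $\mathbb T$ with $$\sup_{\varepsilon\in I}\big(E^\varepsilon[\rho^\varepsilon]+\mathcal G^\varepsilon(\rho^\varepsilon)\big)\le C .$$ Then for every $\varepsilon\in I$ with $\varepsilon<\varepsilon_0$ and all real $x_\varepsilon,y_\varepsilon$ (points of $\mathbb R$, projected to $\mathbb T$) with $$0<y_\varepsilon-x_\varepsilon<\delta,\qquad |\rho^\varepsilon_x(x_\varepsilon)|<L,\qquad |\rho^\varepsilon_x(y_\varepsilon)|<L,$$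 we have either $$d(\rho^\varepsilon(z),\Sigma)<\eta\quad\text{for all }z\in[x_\varepsilon,y_\varepsilon],$$ or $$|\rho^\varepsilon(x_\varepsilon)-\rho^\varepsilon(y_\varepsilon)|<\eta .$$ -/

import Mathlib

open scoped ContDiff

noncomputable section

namespace CahnHilliard

/-! ### The potential `W : [0, ∞) → [0, ∞)`

`W` is a function on `ℝ` of which only the values on `[0, ∞)` matter; its derivatives are taken
within `[0, ∞)`, so they are one-sided at `0`. -/

/-- `W'` on `[0, ∞)`. -/
def dW (W : ℝ → ℝ) (y : ℝ) : ℝ := derivWithin W (Set.Ici 0) y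

/-- `W''` on `[0, ∞)`. -/
def ddW (W : ℝ → ℝ) (y : ℝ) : ℝ := derivWithin (dW W) (Set.Ici 0) y

/-- `Q'(y) = y W'(y) - W(y)`. -/
def dQ (W : ℝ → ℝ) (y : ℝ) : ℝ := y * dW W y - W y

/-- The convex envelope `W**`: the largest convex function on `[0, ∞)` that lies below `W`. -/
def convexEnvelope (W : ℝ → ℝ) (y : ℝ) : ℝ :=
  sSup {r : ℝ | ∃ g : ℝ → ℝ, ConvexOn ℝ (Set.Ici 0) g ∧ (∀ t, 0 ≤ t → g t ≤ W t) ∧ r = g y}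

/-- The unstable set `Σ = cl ({W > W**} ∪ {0})`. -/
def unstableSet (W : ℝ → ℝ) : Set ℝ :=
  closure ({y : ℝ | 0 ≤ y ∧ convexEnvelope W y < W y} ∪ {0})

/-- The standing assumptions on the potential. -/
structure IsPotential (W : ℝ → ℝ) : Prop where
  /-- `W` is twice continuously differentiable on `[0, ∞)`. -/
  contDiffOn : ContDiffOn ℝ 2 W (Set.Ici 0)
  /-- `W` takes values in `[0, ∞)`. -/
  nonneg : ∀ y, 0 ≤ y → 0 ≤ W y
  /-- Growth of `Q'` and `W'`. -/
  growth : ∃ C : ℝ, 0 < C ∧ ∀ y, 0 ≤ y → |dQ W y| ≤ C * (1 + W y) ∧ |dW W y| ≤ C * (1 + W y)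
  /-- `Q'(y) → +∞` as `y → +∞`. -/
  tendsto_dQ : Filter.Tendsto (dQ W) Filter.atTop Filter.atTop
  /-- `Σ` is a finite union of separated compact intervals `[aᵢ, bᵢ]`, listed in increasing order
  (they may be single points). -/
  unstableSet_eq : ∃ (p : ℕ) (a b : Fin p → ℝ), (∀ i, a i ≤ b i) ∧ (∀ i j, i < j → b i < a j) ∧
    unstableSet W = ⋃ i, Set.Icc (a i) (b i)
  /-- `W'' > 0` off the unstable set. -/
  ddW_pos : ∀ y, 0 ≤ y → y ∉ unstableSet W → 0 < ddW W y

/-! ### Calculus on the torus `𝕋 = ℝ / ℤ` -/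

/-- `f : 𝕋 → ℝ` is of class `C^n`, i.e. so is its `1`-periodic lift to `ℝ`. -/
def TorusContDiff (n : ℕ∞) (f : UnitAddCircle → ℝ) : Prop :=
  ContDiff ℝ n (fun t : ℝ => f (t : UnitAddCircle))

/-- The pointwise (classical) derivative of `f : 𝕋 → ℝ`. -/
def torusDeriv (f : UnitAddCircle → ℝ) (x : UnitAddCircle) : ℝ :=
  deriv (fun t : ℝ => f (x + (t : UnitAddCircle))) 0

/-- `v` is the weak derivative of `u` on `𝕋`, tested against all of `C^∞(𝕋)`. -/
def HasWeakDeriv (u v : UnitAddCircle → ℝ) : Prop :=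
  ∀ φ : UnitAddCircle → ℝ, TorusContDiff ⊤ φ →
    ∫ x, u x * torusDeriv φ x = - ∫ x, v x * φ x

/-- `u ∈ H¹(𝕋)`. -/
def MemH1 (u : UnitAddCircle → ℝ) : Prop :=
  MeasureTheory.MemLp u 2 ∧ ∃ v : UnitAddCircle → ℝ, MeasureTheory.MemLp v 2 ∧ HasWeakDeriv u v

open Classical in
/-- The weak derivative `u_x ∈ L²(𝕋)` of `u ∈ H¹(𝕋)` (unique up to null sets). -/
def weakDeriv (u : UnitAddCircle → ℝ) : UnitAddCircle → ℝ :=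
  if h : MemH1 u then h.2.choose else 0

/-- `ρ` is the density of an absolutely continuous probability measure on `𝕋`. -/
structure IsProbDensity (ρ : UnitAddCircle → ℝ) : Prop where
  nonneg : ∀ x, 0 ≤ ρ x
  integrable : MeasureTheory.Integrable ρ
  integral_eq_one : ∫ x, ρ x = 1

/-! ### The functionals `E^ε` and `𝒢^ε` -/

open Classical in
/-- `E^ε[μ] = ∫ (ε² / 2) |μ_x|² + W(μ) dx` if `μ ∈ H¹(𝕋)`, and `+∞` otherwise. -/
def energy (W : ℝ → ℝ) (ε : ℝ) (μ : UnitAddCircle → ℝ) : ENNReal :=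
  if MemH1 μ then ∫⁻ x, ENNReal.ofReal (ε ^ 2 / 2 * weakDeriv μ x ^ 2 + W (μ x)) else ⊤

/-- For `μ ∈ H¹(𝕋)`, the distribution
`G^ε(μ) = μ W'(μ) - W(μ) + (3 ε² / 2) |μ_x|² - ε² (μ μ_x)_x`
applied to the test function `φ`; the derivative in the last term is distributional. -/
def Gdist (W : ℝ → ℝ) (ε : ℝ) (μ φ : UnitAddCircle → ℝ) : ℝ :=
  (∫ x, (dQ W (μ x) + 3 * ε ^ 2 / 2 * weakDeriv μ x ^ 2) * φ x)
    + ε ^ 2 * ∫ x, μ x * weakDeriv μ x * torusDeriv φ x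

/-- `𝒯^ε(μ) = {g ∈ L²(𝕋) : G^ε(μ)_x = √μ g}` in the sense of distributions
(empty if `μ ∉ H¹(𝕋)`). -/
def Tset (W : ℝ → ℝ) (ε : ℝ) (μ : UnitAddCircle → ℝ) : Set (UnitAddCircle → ℝ) :=
  {g | MemH1 μ ∧ MeasureTheory.MemLp g 2 ∧
    ∀ φ : UnitAddCircle → ℝ, TorusContDiff ⊤ φ →
      - Gdist W ε μ (torusDeriv φ) = ∫ x, Real.sqrt (μ x) * g x * φ x}

/-- `𝒢^ε(μ) = inf {‖g‖₂ : g ∈ 𝒯^ε(μ)}`, which is `+∞` if `𝒯^ε(μ)` is empty. -/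
def slope (W : ℝ → ℝ) (ε : ℝ) (μ : UnitAddCircle → ℝ) : ENNReal :=
  ⨅ g ∈ Tset W ε μ, MeasureTheory.eLpNorm g 2 MeasureTheory.volume

end CahnHilliard

end

noncomputable section

namespace CahnHilliard

open Set Filter Topology MeasureTheory

/-! ### The potential off the unstable set. -/

namespace IsPotential

variable {W : ℝ → ℝ}

/-! A density `r` of finite slope solves `dQ(r) + 3ε²/2 r'² - ε² (r r')' = A` with `A' = √r g`, and
where `r > 0` the quantity `h = (W(r) + A - ε²/2 r'²) / r` satisfies `h' = g / √r`. Hence `W(r) = h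
r - A + ε²/2 r'²`. By Cauchy–Schwarz, `A` and (where `r ≥ τ`) `h` are nearly constant on short
intervals, uniformly in `ε`. So `W` lies almost above one fixed affine function on the range of `r`,
and almost touches it at the values taken where `|r'| ≤ L` and `ε L` is small: the end points and
the interior extrema.

If `r` varies by `η` and some value is `η`-far from `Σ`, the contacts at its minimum and maximum put
the convex envelope below the affine function up to a small error. Off `Σ` the envelope is `W`, so
`W` is almost affine on a range of length `η / 2` where `W''` is bounded below, which is absurd
(`exists_chord_gap`, `false_of_range`, `dichotomy`).

If `r` drops below `τ`, `h` is no longer controlled down to the minimum. Instead, `A` must come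
close to `-W(0)` nearby (`exists_A_lt_of_low`), since otherwise `√r` would be too concave; the
affine function then almost touches `W` at `0`, which serves as the second contact.

The uniform bound on `r` comes from the mean and oscillation of `A` together with `dQ → ∞`
(`exists_profile_bound`). The parameter `L` enters only through `ε² L²`, so `δ` does not depend on
it. -/

lemma hasDerivWithinAt (hW : IsPotential W) {y : ℝ} (hy : 0 ≤ y) :
    HasDerivWithinAt W (dW W y) (Ici 0) y :=
  (hW.contDiffOn.differentiableOn (by norm_num) y hy).hasDerivWithinAt

lemma contDiffOn_dW (hW : IsPotential W) : ContDiffOn ℝ 1 (dW W) (Ici 0) :=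
  hW.contDiffOn.derivWithin (uniqueDiffOn_Ici 0) (by norm_num)

lemma hasDerivWithinAt_dW (hW : IsPotential W) {y : ℝ} (hy : 0 ≤ y) :
    HasDerivWithinAt (dW W) (ddW W y) (Ici 0) y :=
  (hW.contDiffOn_dW.differentiableOn (by norm_num) y hy).hasDerivWithinAt

lemma continuousOn_ddW (hW : IsPotential W) : ContinuousOn (ddW W) (Ici 0) :=
  hW.contDiffOn_dW.continuousOn_derivWithin (uniqueDiffOn_Ici 0) le_rfl

lemma continuousOn (hW : IsPotential W) : ContinuousOn W (Ici 0) := hW.contDiffOn.continuousOn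

lemma continuousOn_dQ (hW : IsPotential W) : ContinuousOn (dQ W) (Ici 0) :=
  (continuousOn_id.mul hW.contDiffOn_dW.continuousOn).sub hW.continuousOn

end IsPotential

lemma dQ_zero (W : ℝ → ℝ) : dQ W 0 = - W 0 := by simp [dQ]

lemma le_convexEnvelope_of_notMem {W : ℝ → ℝ} {y : ℝ} (hy : 0 ≤ y) (h : y ∉ unstableSet W) :
    W y ≤ convexEnvelope W y := by
  by_contra! hlt
  exact h (subset_closure (Or.inl ⟨hy, hlt⟩))

/-- The convex envelope lies below every chord of `W`. -/
lemma convexEnvelope_le_affine {W : ℝ → ℝ} (h0 : ∀ y, 0 ≤ y → 0 ≤ W y) {h a m M y : ℝ}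
    (hm : 0 ≤ m) (hy : y ∈ Icc m M) (hWm : W m ≤ h * m - a) (hWM : W M ≤ h * M - a) :
    convexEnvelope W y ≤ h * y - a := by
  -- The zero function is an admissible minorant because `W ≥ 0`, so the supremum is over a nonempty
  -- set.
  refine csSup_le ⟨0, fun _ => 0, convexOn_const 0 (convex_Ici 0), h0, rfl⟩ ?_
  rintro _ ⟨g, hg, hgW, rfl⟩
  have hmM : m ≤ M := hy.1.trans hy.2
  obtain ⟨α, β, hα, hβ, hαβ, rfl⟩ := Icc_subset_segment (𝕜 := ℝ) hy
  have h1 := hg.2 (mem_Ici.2 hm) (mem_Ici.2 (hm.trans hmM)) hα hβ hαβ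
  simp only [smul_eq_mul] at h1 ⊢
  have h2 := mul_le_mul_of_nonneg_left ((hgW m hm).trans hWm) hα
  have h3 := mul_le_mul_of_nonneg_left ((hgW M (hm.trans hmM)).trans hWM) hβ
  have : α * (h * m - a) + β * (h * M - a) = h * (α * m + β * M) - (α + β) * a := by ring
  rw [hαβ, one_mul] at this
  linarith

/-- A quantitative midpoint inequality for a function with second derivative at least `κ`. -/
lemma IsPotential.midpoint_le {W : ℝ → ℝ} (hW : IsPotential W) {κ p l : ℝ} (hp : 0 ≤ p)
    (hl : 0 ≤ l) (hκ : ∀ q ∈ Icc p (p + 2 * l), κ ≤ ddW W q) :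
    2 * W (p + l) + κ * l ^ 2 ≤ W p + W (p + 2 * l) := by
  have hsub : Icc p (p + 2 * l) ⊆ Ici 0 := fun q hq => hp.trans hq.1
  have hconv : ConvexOn ℝ (Icc p (p + 2 * l)) (fun q => W q - κ / 2 * q ^ 2) := by
    refine convexOn_of_hasDerivWithinAt2_nonneg (convex_Icc _ _) (f' := fun q => dW W q - κ * q)
      (f'' := fun q => ddW W q - κ) ?_ ?_ ?_ ?_
    · exact (hW.continuousOn.mono hsub).sub (by fun_prop)
    · intro q hq
      have hq' := interior_subset hq
      have h1 := (hW.hasDerivWithinAt (hsub hq')).mono (interior_subset.trans hsub)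
      have h2 : HasDerivWithinAt (fun q : ℝ => κ / 2 * q ^ 2) (κ * q)
          (interior (Icc p (p + 2 * l))) q :=
        (((hasDerivAt_pow 2 q).const_mul (κ / 2)).congr_deriv
          (by push_cast; ring)).hasDerivWithinAt
      exact h1.sub h2
    · intro q hq
      have hq' := interior_subset hq
      have h1 := (hW.hasDerivWithinAt_dW (hsub hq')).mono (interior_subset.trans hsub)
      have h2 : HasDerivWithinAt (fun q : ℝ => κ * q) κ (interior (Icc p (p + 2 * l))) q := by
        simpa using ((hasDerivAt_id q).const_mul κ).hasDerivWithinAt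
      exact h1.sub h2
    · intro q hq
      linarith [hκ q (interior_subset hq)]
  have h := hconv.2 (left_mem_Icc.2 (by linarith)) (right_mem_Icc.2 (by linarith))
    (show (0 : ℝ) ≤ 1 / 2 by norm_num) (show (0 : ℝ) ≤ 1 / 2 by norm_num) (by norm_num)
  simp only [smul_eq_mul] at h
  rw [show 1 / 2 * p + 1 / 2 * (p + 2 * l) = p + l by ring] at h
  nlinarith

/-- Compactness: `W''` is continuous and positive on the bounded set of points at distance at least
`η` from `Σ`. -/
lemma IsPotential.exists_ddW_lower_bound {W : ℝ → ℝ} (hW : IsPotential W) (R : ℝ) {η : ℝ}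
    (hη : 0 < η) : ∃ κ : ℝ, 0 < κ ∧ ∀ q ∈ Icc 0 R, η ≤ Metric.infDist q (unstableSet W) →
      κ ≤ ddW W q := by
  set S := {q ∈ Icc 0 R | η ≤ Metric.infDist q (unstableSet W)} with hS
  have hcomp : IsCompact S := isCompact_Icc.inter_right
    (isClosed_le continuous_const (Metric.continuous_infDist_pt _))
  rcases S.eq_empty_or_nonempty with he | hne
  · refine ⟨1, one_pos, fun q hq h => ?_⟩
    have : q ∈ S := ⟨hq, h⟩
    simp [he] at this
  · obtain ⟨q0, hq0, hmin⟩ := hcomp.exists_isMinOn hne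
      (hW.continuousOn_ddW.mono fun q hq => hq.1.1)
    refine ⟨ddW W q0, hW.ddW_pos q0 hq0.1.1 fun hmem => ?_, fun q hq h => hmin ⟨hq, h⟩⟩
    have := Metric.infDist_zero_of_mem hmem
    linarith [hq0.2]

/-- Away from the unstable set, `W` cannot be almost above an affine function that it almost
touches from above at two points around. -/
lemma IsPotential.exists_chord_gap {W : ℝ → ℝ} (hW : IsPotential W) (R : ℝ) {η l : ℝ}
    (hη : 0 < η) (hl : 0 < l) : ∃ s : ℝ, 0 < s ∧ ∀ h a m M p : ℝ, 0 ≤ m → m ≤ p → p + 2 * l ≤ M →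
      M ≤ R → (∀ q ∈ Icc p (p + 2 * l), η ≤ Metric.infDist q (unstableSet W)) →
      W m ≤ h * m - a + s → W M ≤ h * M - a + s →
      ¬ ∀ q ∈ Icc p (p + 2 * l), h * q - a - s ≤ W q := by
  obtain ⟨κ, hκ, hb⟩ := hW.exists_ddW_lower_bound R hη
  -- The midpoint inequality gains `κ l²`, while the upper and lower errors cost `4 s` in total;
  -- this choice makes `4 s` half of the gain.
  refine ⟨κ * l ^ 2 / 8, by positivity, fun h a m M p hm hmp hpM hMR hd hWm hWM hlow => ?_⟩
  set s := κ * l ^ 2 / 8 with hs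
  have hp : 0 ≤ p := hm.trans hmp
  have hmid := hW.midpoint_le hp hl.le (κ := κ) fun q hq =>
    hb q ⟨hp.trans hq.1, hq.2.trans (hpM.trans hMR)⟩ (hd q hq)
  -- Off `Σ` there is no gap between `W` and its envelope, so the chord bound for the envelope, with
  -- the line raised by `s`, bounds `W` itself.
  have hup : ∀ q ∈ Icc p (p + 2 * l), W q ≤ h * q - a + s := fun q hq => by
    have h1 := le_convexEnvelope_of_notMem (W := W) (hp.trans hq.1) fun hmem => by
      have := Metric.infDist_zero_of_mem hmem
      linarith [hd q hq]
    have h2 := convexEnvelope_le_affine hW.nonneg (h := h) (a := a - s) hm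
      ⟨hmp.trans hq.1, hq.2.trans hpM⟩ (by linarith) (by linarith)
    linarith
  have h1 := hup p ⟨le_rfl, by linarith⟩
  have h2 := hup (p + 2 * l) ⟨by linarith, le_rfl⟩
  have h3 := hlow (p + l) ⟨by linarith, by linarith⟩
  have : 0 < κ * l ^ 2 := by positivity
  linarith

/-! ### Integration tools for primitives and square-integrable factors. -/

/-- Integration by parts for two primitives of integrable functions. -/
lemma integral_parts_of_primitive {f₁ f₂ F₁ F₂ : ℝ → ℝ} {s t : ℝ}
    (h₁ : IntervalIntegrable f₁ volume s t) (h₂ : IntervalIntegrable f₂ volume s t)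
    (hF₁ : ∀ x ∈ uIcc s t, F₁ x - F₁ s = ∫ y in s..x, f₁ y)
    (hF₂ : ∀ x ∈ uIcc s t, F₂ x - F₂ s = ∫ y in s..x, f₂ y) :
    ∫ x in s..t, (f₁ x * F₂ x + F₁ x * f₂ x) = F₁ t * F₂ t - F₁ s * F₂ s := by
  -- Primitives of integrable functions are absolutely continuous, which suffices for the product
  -- rule almost everywhere.
  have ac (f : ℝ → ℝ) (c : ℝ) (h : IntervalIntegrable f volume s t) :
      AbsolutelyContinuousOnInterval (fun x => c + ∫ y in s..x, f y) s t :=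
    (LipschitzOnWith.absolutelyContinuousOnInterval (K := 0)
      (LipschitzWith.const c).lipschitzOnWith).fun_add
      (h.absolutelyContinuousOnInterval_intervalIntegral left_mem_uIcc)
  have key := (ac f₁ (F₁ s) h₁).integral_deriv_mul_eq_sub (ac f₂ (F₂ s) h₂)
  have e₁ : ∀ x ∈ uIcc s t, F₁ s + ∫ y in s..x, f₁ y = F₁ x := fun x hx => by
    rw [← hF₁ x hx]; ring
  have e₂ : ∀ x ∈ uIcc s t, F₂ s + ∫ y in s..x, f₂ y = F₂ x := fun x hx => by
    rw [← hF₂ x hx]; ring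
  simp only [e₁ t right_mem_uIcc, e₂ t right_mem_uIcc, e₁ s left_mem_uIcc,
    e₂ s left_mem_uIcc] at key
  rw [← key]
  refine intervalIntegral.integral_congr_ae ?_
  filter_upwards [h₁.ae_hasDerivAt_integral, h₂.ae_hasDerivAt_integral] with x hx₁ hx₂ hx
  have hx' := uIoc_subset_uIcc hx
  rw [((hx₁ hx' s left_mem_uIcc).const_add (F₁ s)).deriv,
    ((hx₂ hx' s left_mem_uIcc).const_add (F₂ s)).deriv, e₁ x hx', e₂ x hx']

/-- Cauchy–Schwarz, obtained from a weighted Young inequality. It is the source of the factor `√(t -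
s)` that makes short intervals harmless. -/
lemma abs_integral_mul_le {w g : ℝ → ℝ} {s t B K : ℝ} (hst : s ≤ t) (hK : 0 < K) (hB : 0 ≤ B)
    (hw : ContinuousOn w (uIcc s t)) (hwB : ∀ x ∈ Icc s t, |w x| ≤ B)
    (hg : IntervalIntegrable g volume s t) (hg2 : IntervalIntegrable (fun x => g x ^ 2) volume s t)
    (hle : ∫ x in s..t, g x ^ 2 ≤ K ^ 2) :
    |∫ x in s..t, w x * g x| ≤ B * K * √(t - s) := by
  rcases hst.eq_or_lt with rfl | hlt
  · simp
  set q := √(t - s) with hq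
  have hq0 : 0 < q := Real.sqrt_pos.2 (by linarith)
  have hq2 : q ^ 2 = t - s := Real.sq_sqrt (by linarith)
  have h1 : |∫ x in s..t, w x * g x| ≤
      ∫ x in s..t, (B * (K / q) / 2 + B * q / (2 * K) * g x ^ 2) := by
    refine (intervalIntegral.abs_integral_le_integral_abs hst).trans ?_
    refine intervalIntegral.integral_mono_on hst (hg.continuousOn_mul hw).abs
      (intervalIntegrable_const.add (hg2.const_mul _)) fun x hx => ?_
    rw [abs_mul]
    -- The weights are balanced so that each term contributes at most `B K q / 2` after integration.
    have h2 : |g x| ≤ K / q / 2 + q / (2 * K) * g x ^ 2 := by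
      have : K / q / 2 + q / (2 * K) * g x ^ 2 - |g x| = (K - q * |g x|) ^ 2 / (2 * q * K) := by
        rw [← sq_abs (g x)]; field_simp; ring
      have : 0 ≤ (K - q * |g x|) ^ 2 / (2 * q * K) := by positivity
      linarith
    calc |w x| * |g x| ≤ B * (K / q / 2 + q / (2 * K) * g x ^ 2) :=
          mul_le_mul (hwB x hx) h2 (abs_nonneg _) hB
      _ = _ := by ring
  refine h1.trans ?_
  rw [intervalIntegral.integral_add intervalIntegrable_const (hg2.const_mul _),
    intervalIntegral.integral_const, intervalIntegral.integral_const_mul, ← hq2, smul_eq_mul]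
  have h3 := mul_le_mul_of_nonneg_left hle (show 0 ≤ B * q / (2 * K) by positivity)
  refine (add_le_add_right h3 _).trans (le_of_eq ?_)
  field_simp
  ring

/-! ### Profiles: pointwise consequences of the equation. -/

/-- `r` solves the equation `dQ(r) + 3ε²/2 r'² - ε² (r r')' = A` on `ℝ`, where `A' = √r g`
with `g` locally square integrable. -/
structure IsProfile (W : ℝ → ℝ) (ε K : ℝ) (r r' A g : ℝ → ℝ) : Prop where
  nonneg : ∀ t, 0 ≤ r t
  hasDerivAt : ∀ t, HasDerivAt r (r' t) t
  continuous_deriv : Continuous r'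
  hasDerivAt_flux : ∀ t, HasDerivAt (fun s => r s * r' s)
    ((dQ W (r t) + 3 * ε ^ 2 / 2 * r' t ^ 2 - A t) / ε ^ 2) t
  sub_eq : ∀ s t, A t - A s = ∫ x in s..t, √(r x) * g x
  intervalIntegrable : ∀ s t, IntervalIntegrable g volume s t
  intervalIntegrable_sq : ∀ s t, IntervalIntegrable (fun x => g x ^ 2) volume s t
  integral_sq_le : ∀ s t, s ≤ t → t ≤ s + 1 → ∫ x in s..t, g x ^ 2 ≤ K ^ 2

namespace IsProfile

variable {W : ℝ → ℝ} {ε K : ℝ} {r r' A g : ℝ → ℝ}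

lemma continuous (h : IsProfile W ε K r r' A g) : Continuous r :=
  continuous_iff_continuousAt.2 fun t => (h.hasDerivAt t).continuousAt

lemma intervalIntegrable_sqrt_mul (h : IsProfile W ε K r r' A g) (s t : ℝ) :
    IntervalIntegrable (fun x => √(r x) * g x) volume s t :=
  (h.intervalIntegrable s t).continuousOn_mul h.continuous.sqrt.continuousOn

lemma continuous_A (h : IsProfile W ε K r r' A g) : Continuous A := by
  have : A = fun t => A 0 + ∫ x in (0 : ℝ)..t, √(r x) * g x := by
    ext t; rw [← h.sub_eq]; ring
  rw [this]
  exact continuous_const.add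
    (intervalIntegral.continuous_primitive h.intervalIntegrable_sqrt_mul 0)

lemma abs_A_sub_le (h : IsProfile W ε K r r' A g) (hK : 0 < K) {s t R : ℝ}
    (hst : |t - s| ≤ 1) (hR : ∀ x, r x ≤ R) : |A t - A s| ≤ √R * K * √|t - s| := by
  wlog hle : s ≤ t generalizing s t
  · rw [abs_sub_comm, abs_sub_comm t s]
    exact this (by rwa [abs_sub_comm]) (le_of_not_ge hle)
  rw [abs_of_nonneg (by linarith : (0 : ℝ) ≤ t - s)] at hst ⊢
  rw [h.sub_eq]
  exact abs_integral_mul_le hle hK (Real.sqrt_nonneg _) h.continuous.sqrt.continuousOn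
    (fun x _ => by rw [abs_of_nonneg (Real.sqrt_nonneg _)]; exact Real.sqrt_le_sqrt (hR x))
    (h.intervalIntegrable _ _) (h.intervalIntegrable_sq _ _)
    (h.integral_sq_le _ _ hle (by linarith))

lemma deriv_eq_zero_of_zero (h : IsProfile W ε K r r' A g) {t : ℝ} (ht : r t = 0) : r' t = 0 :=
  IsLocalMin.hasDerivAt_eq_zero (Eventually.of_forall fun s => by rw [ht]; exact h.nonneg s)
    (h.hasDerivAt t)

/-- At a zero of `r` both `r'` and `(r r')'` vanish, so the equation reduces to `A = dQ(0)`. -/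
lemma A_eq_of_zero (h : IsProfile W ε K r r' A g) (hε : 0 < ε) {t : ℝ} (ht : r t = 0) :
    A t = - W 0 := by
  have h0 := h.deriv_eq_zero_of_zero ht
  -- `r'` need not be differentiable at a zero of `r`; the difference quotient of `r r'` is that of
  -- `r` times `r'`, which tends to `r'(t)² = 0`.
  have h1 : HasDerivAt (fun s => r s * r' s) 0 t := by
    rw [hasDerivAt_iff_tendsto_slope]
    have h2 := (hasDerivAt_iff_tendsto_slope.1 (h.hasDerivAt t)).mul
      (h.continuous_deriv.continuousAt (x := t).tendsto.mono_left nhdsWithin_le_nhds)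
    rw [h0, mul_zero] at h2
    refine h2.congr fun s => ?_
    simp [slope_def_field, ht]
    ring
  have h3 := (h.hasDerivAt_flux t).unique h1
  rw [ht, h0, dQ_zero] at h3
  have hε2 : ε ^ 2 ≠ 0 := by positivity
  rw [div_eq_zero_iff] at h3
  rcases h3 with h3 | h3
  · linarith
  · exact absurd h3 hε2

lemma hasDerivAt_deriv (h : IsProfile W ε K r r' A g) (hε : 0 < ε) {t : ℝ} (ht : 0 < r t) :
    HasDerivAt r' ((dQ W (r t) + ε ^ 2 / 2 * r' t ^ 2 - A t) / (ε ^ 2 * r t)) t := by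
  have h1 := (h.hasDerivAt_flux t).fun_div (h.hasDerivAt t) ht.ne'
  have h2 : (fun s => r s * r' s / r s) =ᶠ[𝓝 t] r' := by
    filter_upwards [h.continuous.continuousAt.eventually (lt_mem_nhds ht)] with s hs
    field_simp
  refine (h1.congr_of_eventuallyEq h2.symm).congr_deriv ?_
  field_simp
  ring

/-- At a critical point `ε² r r'' = dQ(r) - A`. A negative value would make the minimum also a local
maximum, hence `r` locally constant and `r'' = 0`. -/
lemma A_le_of_isLocalMin (h : IsProfile W ε K r r' A g) (hε : 0 < ε) {t : ℝ} (ht : 0 < r t)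
    (hmin : IsLocalMin r t) : A t ≤ dQ W (r t) := by
  have h0 : r' t = 0 := hmin.hasDerivAt_eq_zero (h.hasDerivAt t)
  have hd : deriv r = r' := funext fun s => (h.hasDerivAt s).deriv
  have h2 := h.hasDerivAt_deriv hε ht
  by_contra! hlt
  have hneg : deriv (deriv r) t < 0 := by
    rw [hd, h2.deriv, h0]
    exact div_neg_of_neg_of_pos (by nlinarith) (by positivity)
  have hmax := isLocalMax_of_deriv_deriv_neg hneg (by rw [hd, h0]) h.continuous.continuousAt
  have hconst : r =ᶠ[𝓝 t] fun _ => r t := by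
    filter_upwards [hmin, hmax] with s h1 h2 using le_antisymm h2 h1
  have h3 := hconst.deriv.deriv_eq
  simp only [deriv_const', deriv_const] at h3
  linarith

lemma dQ_le_of_isLocalMax (h : IsProfile W ε K r r' A g) (hε : 0 < ε) {t : ℝ} (ht : 0 < r t)
    (hmax : IsLocalMax r t) : dQ W (r t) ≤ A t := by
  have h0 : r' t = 0 := hmax.hasDerivAt_eq_zero (h.hasDerivAt t)
  have hd : deriv r = r' := funext fun s => (h.hasDerivAt s).deriv
  have h2 := h.hasDerivAt_deriv hε ht
  by_contra! hlt
  have hpos : 0 < deriv (deriv r) t := by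
    rw [hd, h2.deriv, h0]
    exact div_pos (by nlinarith) (by positivity)
  have hmin := isLocalMin_of_deriv_deriv_pos hpos (by rw [hd, h0]) h.continuous.continuousAt
  have hconst : r =ᶠ[𝓝 t] fun _ => r t := by
    filter_upwards [hmin, hmax] with s h1 h2 using le_antisymm h2 h1
  have h3 := hconst.deriv.deriv_eq
  simp only [deriv_const', deriv_const] at h3
  linarith

/-! ### Behaviour near vacuum. -/

/-- On an interval where `0 < r ≤ τ` and `A ≥ dQ(r) + σ`, the function `√r` is very concave, which
forces the interval to be short. -/
lemma length_le_of_low (h : IsProfile W ε K r r' A g) (hε : 0 < ε) {a b τ σ : ℝ} (hab : a ≤ b)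
    (hσ : 0 ≤ σ) (hpos : ∀ t ∈ Icc a b, 0 < r t) (hτ : ∀ t ∈ Icc a b, r t ≤ τ)
    (hA : ∀ t ∈ Icc a b, dQ W (r t) + σ ≤ A t) : σ * (b - a) ^ 2 ≤ 16 * ε ^ 2 * τ ^ 2 := by
  set T := √τ with hT
  have hτ0 : 0 < τ := (hpos a (left_mem_Icc.2 hab)).trans_le (hτ a (left_mem_Icc.2 hab))
  have hT0 : 0 < T := Real.sqrt_pos.2 hτ0
  have hT2 : T ^ 2 = τ := Real.sq_sqrt hτ0.le
  -- The square root eliminates the gradient term: `(√r)'' = -(A - dQ(r)) / (2 ε² r^(3/2))`, which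
  -- is at most `-B`.
  set B := σ / (2 * ε ^ 2 * T ^ 3) with hB
  have hconc : ConcaveOn ℝ (Icc a b) (fun t => √(r t) - B / 2 * ((t - a) * (b - t))) := by
    refine concaveOn_of_hasDerivWithinAt2_nonpos (convex_Icc _ _)
      (f' := fun t => r' t / (2 * √(r t)) - B / 2 * (a + b - 2 * t))
      (f'' := fun t => (((dQ W (r t) + ε ^ 2 / 2 * r' t ^ 2 - A t) / (ε ^ 2 * r t)) *
        (2 * √(r t)) - r' t * (2 * (r' t / (2 * √(r t))))) / (2 * √(r t)) ^ 2 + B) ?_ ?_ ?_ ?_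
    · exact (h.continuous.sqrt.sub (by fun_prop)).continuousOn
    · intro t ht
      refine HasDerivAt.hasDerivWithinAt ?_
      refine ((h.hasDerivAt t).sqrt (hpos t (interior_subset ht)).ne').sub ?_
      convert! (((hasDerivAt_id t).sub_const a).mul ((hasDerivAt_id t).const_sub b)).const_mul
        (B / 2) using 1
      simp only [id]; ring
    · intro t ht
      refine HasDerivAt.hasDerivWithinAt ?_
      have hr := hpos t (interior_subset ht)
      have h1 := (h.hasDerivAt_deriv hε hr).fun_div
        (((h.hasDerivAt t).sqrt hr.ne').const_mul 2) (by positivity)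
      have h2 : HasDerivAt (fun t => B / 2 * (a + b - 2 * t)) (-B) t := by
        convert! (((hasDerivAt_id t).const_mul 2).const_sub (a + b)).const_mul (B / 2) using 1
        ring
      convert! h1.sub h2 using 1
      ring
    · intro t ht
      have ht' := interior_subset ht
      have hr := hpos t ht'
      set u := √(r t) with hu
      have hu0 : 0 < u := Real.sqrt_pos.2 hr
      have hu2 : r t = u ^ 2 := (Real.sq_sqrt hr.le).symm
      have huT : u ≤ T := Real.sqrt_le_sqrt (hτ t ht')
      have hA' := hA t ht'
      have e : (((dQ W (r t) + ε ^ 2 / 2 * r' t ^ 2 - A t) / (ε ^ 2 * r t)) *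
        (2 * u) - r' t * (2 * (r' t / (2 * u)))) / (2 * u) ^ 2 =
          - ((A t - dQ W (r t)) / (2 * ε ^ 2 * u ^ 3)) := by
        generalize dQ W (r t) = d
        rw [hu2]; field_simp; ring
      rw [e]
      have : B ≤ (A t - dQ W (r t)) / (2 * ε ^ 2 * u ^ 3) := by
        rw [hB]
        gcongr <;> linarith
      linarith
  -- At the midpoint the parabola equals `(b - a)² / 4`, so concavity and `√r ≥ 0` at the ends give
  -- `B (b - a)² / 8 ≤ T`.
  have hmid := hconc.2 (left_mem_Icc.2 hab) (right_mem_Icc.2 hab)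
    (show (0 : ℝ) ≤ 1 / 2 by norm_num) (show (0 : ℝ) ≤ 1 / 2 by norm_num) (by norm_num)
  simp only [smul_eq_mul] at hmid
  have hm : 1 / 2 * a + 1 / 2 * b ∈ Icc a b := ⟨by linarith, by linarith⟩
  have h1 : √(r (1 / 2 * a + 1 / 2 * b)) ≤ T := Real.sqrt_le_sqrt (hτ _ hm)
  have h2 := Real.sqrt_nonneg (r a)
  have h3 := Real.sqrt_nonneg (r b)
  have h4 : B * (b - a) ^ 2 ≤ 8 * T := by nlinarith
  rw [hB, div_mul_eq_mul_div, div_le_iff₀ (by positivity)] at h4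
  calc σ * (b - a) ^ 2 ≤ 8 * T * (2 * ε ^ 2 * T ^ 3) := h4
    _ = 16 * ε ^ 2 * (T ^ 2) ^ 2 := by ring
    _ = _ := by rw [hT2]

/-- If `r` takes a small value at `t`, then `A` cannot stay well above `-W(0)` around `t`. -/
lemma exists_A_lt_of_low (h : IsProfile W ε K r r' A g) (hε : 0 < ε) {t d τ σ : ℝ} (hd : 0 ≤ d)
    (hσ : 0 < σ) (ht : r t ≤ τ) (hτ : ∀ q ∈ Icc 0 τ, dQ W q ≤ - W 0 + σ / 2)
    (hsmall : 16 * ε ^ 2 * τ ^ 2 < σ / 2 * d ^ 2) :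
    ∃ s ∈ Icc (t - d) (t + d), A s < - W 0 + σ := by
  by_contra! hA
  have hpos : ∀ s ∈ Icc (t - d) (t + d), 0 < r s := fun s hs => by
    refine (h.nonneg s).lt_of_ne fun h0 => ?_
    have := h.A_eq_of_zero hε h0.symm
    linarith [hA s hs]
  -- Were `r` to exceed `r t` on both sides, an interior minimum at a low level would force `A ≤
  -- dQ(r)` there. So `r` stays low on a whole side, of length `d`, too long for `length_le_of_low`.
  have hside : (∀ s ∈ Icc (t - d) t, r s ≤ r t) ∨ (∀ s ∈ Icc t (t + d), r s ≤ r t) := by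
    by_contra! hcon
    obtain ⟨⟨s₁, hs₁, h₁⟩, s₂, hs₂, h₂⟩ := hcon
    obtain ⟨c, hc, hmin⟩ := isCompact_Icc.exists_isMinOn (nonempty_Icc.2 (hs₁.2.trans hs₂.1))
      h.continuous.continuousOn
    have hct : r c ≤ r t := hmin ⟨hs₁.2, hs₂.1⟩
    have hc₁ : s₁ < c := hc.1.lt_of_ne (by rintro rfl; linarith)
    have hc₂ : c < s₂ := hc.2.lt_of_ne (by rintro rfl; linarith)
    have hcm : c ∈ Icc (t - d) (t + d) := ⟨hs₁.1.trans hc.1, hc.2.trans hs₂.2⟩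
    have := h.A_le_of_isLocalMin hε (hpos c hcm) (hmin.isLocalMin (Icc_mem_nhds hc₁ hc₂))
    linarith [hA c hcm, hτ (r c) ⟨h.nonneg c, hct.trans ht⟩]
  have hkey : ∀ a b, a ≤ b → b - a = d → Icc a b ⊆ Icc (t - d) (t + d) →
      (∀ s ∈ Icc a b, r s ≤ r t) → False := fun a b hab hba hsub hle => by
    have := h.length_le_of_low hε (σ := σ / 2) hab (by positivity) (fun s hs => hpos s (hsub hs))
      (fun s hs => (hle s hs).trans ht) fun s hs => by
        linarith [hA s (hsub hs), hτ (r s) ⟨h.nonneg s, (hle s hs).trans ht⟩]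
    rw [hba] at this
    linarith
  rcases hside with hs | hs
  · exact hkey (t - d) t (by linarith) (by ring) (Icc_subset_Icc le_rfl (by linarith)) hs
  · exact hkey t (t + d) (by linarith) (by ring) (Icc_subset_Icc (by linarith) le_rfl) hs

/-! ### The first integral and its oscillation. -/

/-- The first integral `(W(r) + A - ε²/2 r'²) / r`, formally `W'(r) - ε² r''`. -/
def potential (W : ℝ → ℝ) (ε : ℝ) (r r' A : ℝ → ℝ) (t : ℝ) : ℝ :=
  (W (r t) + A t - ε ^ 2 / 2 * r' t ^ 2) / r t

/-- `A` is only absolutely continuous, so `A / r` is integrated by parts. The rest of `potential` is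
differentiable in the classical sense with derivative `A r' / r²`, by the equation for `r''`, and
this cancels the term produced by differentiating `1 / r`. -/
lemma potential_sub_eq (h : IsProfile W ε K r r' A g) (hW : IsPotential W) (hε : 0 < ε) {s t : ℝ}
    (hpos : ∀ x ∈ uIcc s t, 0 < r x) :
    potential W ε r r' A t - potential W ε r r' A s = ∫ x in s..t, √(r x) / r x * g x := by
  have hne : ∀ x ∈ uIcc s t, r x ≠ 0 := fun x hx => (hpos x hx).ne'
  have c1 : ContinuousOn (fun x => r' x / r x ^ 2) (uIcc s t) :=
    h.continuous_deriv.continuousOn.div (h.continuous.pow 2).continuousOn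
      fun x hx => pow_ne_zero 2 (hne x hx)
  have d1 : ∀ x ∈ uIcc s t, HasDerivAt (fun y => (r y)⁻¹) (-(r' x / r x ^ 2)) x := fun x hx => by
    have := (h.hasDerivAt x).fun_inv (hne x hx)
    rwa [neg_div] at this
  have d2 : ∀ x ∈ uIcc s t, HasDerivAt (fun y => (W (r y) - ε ^ 2 / 2 * r' y ^ 2) / r y)
      (A x * (r' x / r x ^ 2)) x := fun x hx => by
    have e1 : HasDerivAt (fun y => W (r y)) (dW W (r x) * r' x) x :=
      (hW.hasDerivWithinAt (h.nonneg x)).comp_hasDerivAt x (h.hasDerivAt x)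
        (Eventually.of_forall h.nonneg)
    have e2 := ((h.hasDerivAt_deriv hε (hpos x hx)).fun_pow 2).const_mul (ε ^ 2 / 2)
    refine ((e1.sub e2).fun_div (h.hasDerivAt x) (hne x hx)).congr_deriv ?_
    have := hne x hx
    simp only [dQ, Pi.sub_apply]
    field_simp
    ring
  have i1 : IntervalIntegrable (fun x => A x * (r' x / r x ^ 2)) volume s t :=
    (h.continuous_A.continuousOn.mul c1).intervalIntegrable
  have f2 := intervalIntegral.integral_eq_sub_of_hasDerivAt d2 i1
  have hsub : ∀ x ∈ uIcc s t, uIcc s x ⊆ uIcc s t := fun x hx =>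
    uIcc_subset_uIcc left_mem_uIcc hx
  have f1 := integral_parts_of_primitive (h.intervalIntegrable_sqrt_mul s t)
    (c1.neg.intervalIntegrable) (F₁ := A) (F₂ := fun y => (r y)⁻¹) (fun x _ => h.sub_eq s x)
    fun x hx => (intervalIntegral.integral_eq_sub_of_hasDerivAt
      (fun y hy => d1 y (hsub x hx hy)) ((c1.mono (hsub x hx)).neg.intervalIntegrable)).symm
  have c2 : ContinuousOn (fun x => √(r x) / r x) (uIcc s t) :=
    h.continuous.sqrt.continuousOn.div h.continuous.continuousOn hne
  have e3 : ∫ x in s..t, (√(r x) * g x * (r x)⁻¹ + A x * -(r' x / r x ^ 2)) =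
      (∫ x in s..t, √(r x) / r x * g x) - ∫ x in s..t, A x * (r' x / r x ^ 2) := by
    rw [← intervalIntegral.integral_sub ((h.intervalIntegrable s t).continuousOn_mul c2) i1]
    refine intervalIntegral.integral_congr fun x _ => ?_
    ring
  have e4 : ∀ x, potential W ε r r' A x =
      (W (r x) - ε ^ 2 / 2 * r' x ^ 2) / r x + A x * (r x)⁻¹ := fun x => by
    rw [potential]; ring
  simp only [Pi.neg_apply] at f1
  rw [e4, e4]
  linarith

lemma abs_potential_sub_le (h : IsProfile W ε K r r' A g) (hW : IsPotential W) (hε : 0 < ε)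
    (hK : 0 < K) {s t τ : ℝ} (hst : |t - s| ≤ 1) (hτ : 0 < τ) (hr : ∀ x ∈ uIcc s t, τ ≤ r x) :
    |potential W ε r r' A t - potential W ε r r' A s| ≤ K * √|t - s| / √τ := by
  wlog hle : s ≤ t generalizing s t
  · rw [abs_sub_comm, abs_sub_comm t s]
    exact this (by rwa [abs_sub_comm]) (by rwa [uIcc_comm]) (le_of_not_ge hle)
  rw [abs_of_nonneg (by linarith : (0 : ℝ) ≤ t - s)] at hst ⊢
  have hpos : ∀ x ∈ uIcc s t, 0 < r x := fun x hx => hτ.trans_le (hr x hx)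
  rw [h.potential_sub_eq hW hε hpos]
  have := abs_integral_mul_le hle hK (B := (√τ)⁻¹) (by positivity)
    (h.continuous.sqrt.continuousOn.div h.continuous.continuousOn fun x hx => (hpos x hx).ne')
    (fun x hx => by
      rw [← uIcc_of_le hle] at hx
      change |√(r x) / r x| ≤ _
      rw [Real.sqrt_div_self, abs_of_nonneg (by positivity)]
      have := hr x hx
      gcongr)
    (h.intervalIntegrable s t) (h.intervalIntegrable_sq s t)
    (h.integral_sq_le _ _ hle (by linarith))
  refine this.trans (le_of_eq ?_)
  field_simp

end IsProfile

/-- `c` is the crossing of the level `τ` nearest to `t`; reflection reduces to `w ≤ t`. It cuts the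
near-vacuum region off, so that `potential` is controlled up to `t`. -/
lemma exists_eq_and_forall_le_of_le {r : ℝ → ℝ} (hr : Continuous r) {w t τ : ℝ} (hw : r w ≤ τ)
    (ht : τ ≤ r t) : ∃ c ∈ uIcc w t, r c = τ ∧ ∀ x ∈ uIcc c t, τ ≤ r x := by
  wlog hwt : w ≤ t generalizing r w t
  · obtain ⟨c, hc, hcτ, hle⟩ := this (r := fun x => r (-x)) (hr.comp continuous_neg) (w := -w)
      (t := -t) (by simpa) (by simpa) (by linarith)
    refine ⟨-c, ?_, hcτ, fun x hx => ?_⟩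
    · rw [mem_uIcc] at hc ⊢
      rcases hc with hc | hc
      · right; constructor <;> linarith [hc.1, hc.2]
      · left; constructor <;> linarith [hc.1, hc.2]
    · have := hle (-x) (by
        rw [mem_uIcc] at hx ⊢
        rcases hx with hx | hx
        · right; constructor <;> linarith [hx.1, hx.2]
        · left; constructor <;> linarith [hx.1, hx.2])
      simpa using this
  have hcomp : IsCompact (Icc w t ∩ {x | r x ≤ τ}) :=
    isCompact_Icc.inter_right (isClosed_le hr continuous_const)
  obtain ⟨c, ⟨hc, hcτ⟩, hmax⟩ := hcomp.exists_isGreatest ⟨w, ⟨le_rfl, hwt⟩, hw⟩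
  have key : ∀ x ∈ Icc c t, τ ≤ r x := fun x hx => by
    by_contra! hlt
    obtain ⟨y, hy, hyτ⟩ := intermediate_value_Icc hx.2 hr.continuousOn ⟨hlt.le, ht⟩
    have hyc : y ≤ c := hmax ⟨⟨hc.1.trans (hx.1.trans hy.1), hy.2⟩, hyτ.le⟩
    have : x = y := le_antisymm hy.1 (hyc.trans hx.1)
    rw [this] at hlt
    linarith
  refine ⟨c, by rwa [uIcc_of_le hwt], le_antisymm hcτ (key c ⟨le_rfl, hc.2⟩), ?_⟩
  rwa [uIcc_of_le hc.2]

/-! ### Contact with an affine function and the dichotomy. -/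

namespace IsProfile

variable {W : ℝ → ℝ} {ε K : ℝ} {r r' A g : ℝ → ℝ}

/-- The geometric content of the first integral: the gradient term is nonnegative, and it is the
only obstruction to contact with the line. -/
lemma eq_potential_mul (W : ℝ → ℝ) (ε : ℝ) {r : ℝ → ℝ} (r' A : ℝ → ℝ) {t : ℝ} (ht : 0 < r t) :
    W (r t) = potential W ε r r' A t * r t - A t + ε ^ 2 / 2 * r' t ^ 2 := by
  rw [potential, div_mul_cancel₀ _ ht.ne']
  ring

/-- On an interval where `r ≥ τ`, the affine function with slope `potential` and intercept `-A`,
frozen at one end point, almost bounds `W` from below on the range of `r`. -/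
lemma abs_affine_sub_le (h : IsProfile W ε K r r' A g) (hW : IsPotential W) (hε : 0 < ε)
    (hK : 0 < K) {c t τ R s δ : ℝ} (hτ : 0 < τ) (hR : ∀ x, r x ≤ R) (hδ : δ ≤ 1)
    (hct : |t - c| ≤ δ) (hlow : ∀ x ∈ uIcc c t, τ ≤ r x)
    (hs : K * √δ / √τ * R + √R * K * √δ ≤ s) {x : ℝ} (hx : x ∈ uIcc c t) :
    |(potential W ε r r' A x * r x - A x) - (potential W ε r r' A t * r x - A t)| ≤ s := by
  have hxt : |x - t| ≤ δ := by
    rw [uIcc_comm] at hx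
    rw [abs_sub_comm] at hct
    exact (abs_sub_left_of_mem_uIcc hx).trans hct
  have h1 := h.abs_potential_sub_le hW hε hK (s := t) (t := x) (hxt.trans hδ) hτ
    fun y hy => hlow y (uIcc_subset_uIcc right_mem_uIcc hx hy)
  have h2 := h.abs_A_sub_le hK (s := t) (t := x) (hxt.trans hδ) hR
  have hsq : √|x - t| ≤ √δ := Real.sqrt_le_sqrt hxt
  have h3 : |(potential W ε r r' A x - potential W ε r r' A t) * r x| ≤ K * √δ / √τ * R := by
    rw [abs_mul, abs_of_nonneg (h.nonneg x)]
    have hR0 : 0 ≤ R := (h.nonneg x).trans (hR x)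
    refine mul_le_mul (h1.trans ?_) (hR x) (h.nonneg x) (by positivity)
    gcongr
  have h4 : |A x - A t| ≤ √R * K * √δ := h2.trans (by gcongr)
  calc _ = |(potential W ε r r' A x - potential W ε r r' A t) * r x - (A x - A t)| := by
        congr 1; ring
    _ ≤ _ := abs_sub _ _
    _ ≤ s := by linarith

/-- If `r` is above `τ` between `c` and `t`, the point `t` is nearly critical and the affine
function frozen at `t` almost touches `W` from above at some `m`, then the range of `r` between
`c` and `t` contains no interval of length `2 * l` far from the unstable set. -/
lemma false_of_range (h : IsProfile W ε K r r' A g) (hW : IsPotential W) (hε : 0 < ε)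
    (hK : 0 < K) {c t τ R s δ L m p l η : ℝ} (hτ : 0 < τ) (hR : ∀ x, r x ≤ R) (hδ : δ ≤ 1)
    (hct : |t - c| ≤ δ) (hlow : ∀ x ∈ uIcc c t, τ ≤ r x)
    (hs : K * √δ / √τ * R + √R * K * √δ ≤ s) (hL : |r' t| ≤ L) (hεL : ε ^ 2 / 2 * L ^ 2 ≤ s)
    (hgap : ∀ h a m M p : ℝ, 0 ≤ m → m ≤ p → p + 2 * l ≤ M →
      M ≤ R → (∀ q ∈ Icc p (p + 2 * l), η ≤ Metric.infDist q (unstableSet W)) →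
      W m ≤ h * m - a + s → W M ≤ h * M - a + s →
      ¬ ∀ q ∈ Icc p (p + 2 * l), h * q - a - s ≤ W q)
    (hm : 0 ≤ m) (hmp : m ≤ p) (hcp : r c ≤ p) (hpt : p + 2 * l ≤ r t)
    (hη : ∀ q ∈ Icc p (p + 2 * l), η ≤ Metric.infDist q (unstableSet W))
    (hWm : W m ≤ potential W ε r r' A t * m - A t + s) : False := by
  have hsq : r' t ^ 2 ≤ L ^ 2 := sq_le_sq' (abs_le.1 hL).1 (abs_le.1 hL).2
  refine hgap (potential W ε r r' A t) (A t) m (r t) p hm hmp hpt (hR t) hη hWm ?_ fun q hq => ?_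
  · rw [eq_potential_mul W ε r' A (hτ.trans_le (hlow t right_mem_uIcc))]
    nlinarith
  -- By the intermediate value theorem each `q` is a value of `r` between `c` and `t`, where the
  -- affine lower bound holds.
  · have hq' : q ∈ uIcc (r c) (r t) := by
      rw [mem_uIcc]; left; exact ⟨hcp.trans hq.1, hq.2.trans hpt⟩
    obtain ⟨x, hx, rfl⟩ := intermediate_value_uIcc h.continuous.continuousOn hq'
    have h1 := (abs_le.1 (h.abs_affine_sub_le hW hε hK hτ hR hδ hct hlow hs hx)).1
    have h2 := eq_potential_mul W ε r' A (hτ.trans_le (hlow x hx))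
    have h3 : 0 ≤ ε ^ 2 / 2 * r' x ^ 2 := by positivity
    linarith

/-- The dichotomy for a single profile. -/
theorem dichotomy (h : IsProfile W ε K r r' A g) (hW : IsPotential W) (hε : 0 < ε)
    (hK : 0 < K) {τ R s δ L η x y : ℝ} (hτ : 0 < τ) (hτη : τ ≤ η / 2)
    (hR : ∀ x, r x ≤ R) (hδ : δ ≤ 1 / 2) (hxy : x ≤ y) (hyx : y - x ≤ δ) (hs0 : 0 < s)
    (hs : K * √δ / √τ * R + √R * K * √δ ≤ s / 2) (hsA : √R * K * √(2 * δ) ≤ s / 2)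
    (hεL : ε ^ 2 / 2 * L ^ 2 ≤ s / 2) (hx : |r' x| ≤ L) (hy : |r' y| ≤ L)
    (hτQ : ∀ q ∈ Icc 0 τ, dQ W q ≤ - W 0 + s / 2 / 2)
    (hετ : 16 * ε ^ 2 * τ ^ 2 < s / 2 / 2 * δ ^ 2)
    (hgap : ∀ h a m M p : ℝ, 0 ≤ m → m ≤ p → p + 2 * (η / 4) ≤ M →
      M ≤ R → (∀ q ∈ Icc p (p + 2 * (η / 4)), η / 2 ≤ Metric.infDist q (unstableSet W)) →
      W m ≤ h * m - a + s → W M ≤ h * M - a + s →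
      ¬ ∀ q ∈ Icc p (p + 2 * (η / 4)), h * q - a - s ≤ W q) :
    (∀ z ∈ Icc x y, Metric.infDist (r z) (unstableSet W) < η) ∨ |r x - r y| < η := by
  by_contra! hcon
  obtain ⟨⟨z, hz, hzη⟩, hxyη⟩ := hcon
  have hδ1 : δ ≤ 1 := by linarith
  have hL0 : 0 ≤ L := (abs_nonneg _).trans hx
  have hzero : (0 : ℝ) ∈ unstableSet W := subset_closure (Or.inr rfl)
  -- Since `0 ∈ Σ`, being far from `Σ` means being away from vacuum.
  have hrz : η ≤ r z := by
    have := Metric.infDist_le_dist_of_mem (x := r z) hzero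
    rw [Real.dist_eq, sub_zero, abs_of_nonneg (h.nonneg z)] at this
    linarith
  have hfar : ∀ p, p ≤ r z → r z ≤ p + 2 * (η / 4) →
      ∀ q ∈ Icc p (p + 2 * (η / 4)), η / 2 ≤ Metric.infDist q (unstableSet W) :=
    fun p hp1 hp2 q hq => by
      have h1 := Metric.infDist_le_infDist_add_dist (s := unstableSet W) (x := r z) (y := q)
      have h2 : dist (r z) q ≤ η / 2 := by
        rw [Real.dist_eq, abs_le]
        constructor <;> linarith [hq.1, hq.2]
      linarith
  -- near critical points at the extrema
  have hext : ∀ t ∈ Icc x y, IsExtrOn r (Icc x y) t → |r' t| ≤ L := fun t ht hext => by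
    rcases ht.1.eq_or_lt with rfl | h1
    · exact hx
    rcases ht.2.eq_or_lt with rfl | h2
    · exact hy
    rw [(hext.isLocalExtr (Icc_mem_nhds h1 h2)).hasDerivAt_eq_zero (h.hasDerivAt t), abs_zero]
    exact hL0
  have hdist : ∀ u ∈ Icc x y, ∀ v ∈ Icc x y, |u - v| ≤ δ := fun u hu v hv => by
    rw [abs_le]; constructor <;> linarith [hu.1, hu.2, hv.1, hv.2]
  obtain ⟨t, ht, hmax⟩ := isCompact_Icc.exists_isMaxOn (nonempty_Icc.2 hxy)
    h.continuous.continuousOn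
  obtain ⟨c, hc, hmin⟩ := isCompact_Icc.exists_isMinOn (nonempty_Icc.2 hxy)
    h.continuous.continuousOn
  have htL := hext t ht hmax.isExtr
  have hcL := hext c hc hmin.isExtr
  have hzt : r z ≤ r t := hmax hz
  have hcz : r c ≤ r z := hmin hz
  rcases le_total τ (r c) with hcτ | hcτ
  · have hsub : uIcc c t ⊆ Icc x y := by
      rw [uIcc]; exact Icc_subset_Icc (le_inf hc.1 ht.1) (sup_le hc.2 ht.2)
    have hlow : ∀ u ∈ uIcc c t, τ ≤ r u := fun u hu => hcτ.trans (hmin (hsub hu))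
    have hgap' : η ≤ r t - r c := by
      have h1 : r x ≤ r t := hmax ⟨le_rfl, hxy⟩
      have h2 : r y ≤ r t := hmax ⟨hxy, le_rfl⟩
      have h3 : r c ≤ r x := hmin ⟨le_rfl, hxy⟩
      have h4 : r c ≤ r y := hmin ⟨hxy, le_rfl⟩
      have := hxyη.trans (abs_le.2 ⟨by linarith, by linarith⟩ : |r x - r y| ≤ r t - r c)
      exact this
    have hWc : W (r c) ≤ potential W ε r r' A t * r c - A t + s := by
      rw [eq_potential_mul W ε r' A (hτ.trans_le hcτ)]
      have h1 := (abs_le.1 (h.abs_affine_sub_le hW hε hK hτ hR hδ1 (hdist t ht c hc) hlow hs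
        left_mem_uIcc)).2
      have hsq : r' c ^ 2 ≤ L ^ 2 := sq_le_sq' (abs_le.1 hcL).1 (abs_le.1 hcL).2
      nlinarith
    -- A window of length `η / 2` that contains `r z` and fits in the range `[r c, r t]`, whose
    -- length is at least `η`: it starts at `r z` if there is room above, and ends there otherwise.
    obtain ⟨p, hp1, hp2, hp3, hp4⟩ : ∃ p, r c ≤ p ∧ p + 2 * (η / 4) ≤ r t ∧ p ≤ r z ∧
        r z ≤ p + 2 * (η / 4) := by
      rcases le_total (r z + η / 2) (r t) with hle | hle
      · exact ⟨r z, hcz, by linarith, le_rfl, by linarith⟩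
      · exact ⟨r z - η / 2, by linarith, by linarith, by linarith, by linarith⟩
    exact h.false_of_range hW hε hK hτ hR hδ1 (hdist t ht c hc) hlow (hs.trans (by linarith))
      htL (hεL.trans (by linarith)) hgap (h.nonneg c) hp1 hp1 hp2 (hfar p hp3 hp4) hWc
  · obtain ⟨c', hc', hcτ', hlow⟩ := exists_eq_and_forall_le_of_le h.continuous hcτ
      (by linarith : τ ≤ r t)
    have hc'' : c' ∈ Icc x y := by
      rw [uIcc] at hc'
      exact Icc_subset_Icc (le_inf hc.1 ht.1) (sup_le hc.2 ht.2) hc'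
    have hδ0 : 0 ≤ δ := (sub_nonneg.2 hxy).trans hyx
    -- Some `v` within `δ` of the minimum has `A v < -W(0) + s / 2`. It lies within `2 δ` of `t`,
    -- which is why the threshold `hsA` involves `2 * δ`.
    obtain ⟨v, hv, hAv⟩ := h.exists_A_lt_of_low hε hδ0 (by positivity) hcτ hτQ hετ
    have hvt : |t - v| ≤ 2 * δ := by
      rw [abs_le]; constructor <;> linarith [hv.1, hv.2, ht.1, ht.2, hc.1, hc.2]
    have hAt := (abs_le.1 (h.abs_A_sub_le hK (hvt.trans (by linarith)) hR)).2
    have hAt' : √R * K * √|t - v| ≤ s / 2 := le_trans (by gcongr) hsA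
    -- The lower contact is at `m = 0`, a value that `r` need not attain. The window `[r z - η / 2,
    -- r z]` lies above `τ = r c'` because `τ ≤ η / 2 ≤ r z - η / 2`.
    exact h.false_of_range hW hε hK hτ hR hδ1 (hdist t ht c' hc'') hlow (hs.trans (by linarith))
      htL (hεL.trans (by linarith)) hgap (m := 0) (p := r z - η / 2) le_rfl (by linarith)
      (by linarith) (by linarith) (hfar _ (by linarith) (by linarith)) (by linarith)

end IsProfile

/-- Uniform smallness thresholds for profiles bounded by `R`. -/
theorem IsPotential.exists_thresholds {W : ℝ → ℝ} (hW : IsPotential W) {η K R : ℝ} (hη : 0 < η)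
    (hK : 0 < K) : ∃ δ : ℝ, 0 < δ ∧ ∀ L : ℝ, 0 ≤ L → ∃ ε₀ : ℝ, 0 < ε₀ ∧
      ∀ (ε : ℝ) (r r' A g : ℝ → ℝ), 0 < ε → ε < ε₀ → IsProfile W ε K r r' A g →
        (∀ t, r t ≤ R) → ∀ x y : ℝ, 0 < y - x → y - x < δ → |r' x| < L → |r' y| < L →
          (∀ z ∈ Icc x y, Metric.infDist (r z) (unstableSet W) < η) ∨ |r x - r y| < η := by
  -- A window of length `η / 2` containing a value `η`-far from `Σ` remains `η / 2`-far from it.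
  obtain ⟨s, hs, hgap⟩ := hW.exists_chord_gap R (half_pos hη) (by positivity : 0 < η / 4)
  obtain ⟨τ, hτ, hτη, hτQ⟩ : ∃ τ, 0 < τ ∧ τ ≤ η / 2 ∧
      ∀ q ∈ Icc 0 τ, dQ W q ≤ - W 0 + s / 2 / 2 := by
    have hc := hW.continuousOn_dQ 0 (mem_Ici.2 le_rfl)
    obtain ⟨d, hd, hd'⟩ := Metric.continuousWithinAt_iff.1 hc (s / 2 / 2) (by positivity)
    refine ⟨min (d / 2) (η / 2), by positivity, min_le_right _ _, fun q hq => ?_⟩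
    have h1 := hd' (mem_Ici.2 hq.1) (by
      rw [Real.dist_eq, sub_zero, abs_of_nonneg hq.1]
      have := hq.2.trans (min_le_left _ _)
      linarith)
    rw [Real.dist_eq, dQ_zero] at h1
    linarith [(abs_lt.1 h1).2]
  obtain ⟨δ, hδ, hδ1, hs1, hs2⟩ : ∃ δ, 0 < δ ∧ δ ≤ 1 / 2 ∧
      K * √δ / √τ * R + √R * K * √δ ≤ s / 2 ∧ √R * K * √(2 * δ) ≤ s / 2 := by
    have t1 : Tendsto (fun δ => K * √δ / √τ * R + √R * K * √δ) (𝓝[>] 0) (𝓝 0) := by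
      have : Continuous fun δ => K * √δ / √τ * R + √R * K * √δ := by fun_prop
      simpa using (this.tendsto 0).mono_left nhdsWithin_le_nhds
    have t2 : Tendsto (fun δ => √R * K * √(2 * δ)) (𝓝[>] 0) (𝓝 0) := by
      have : Continuous fun δ => √R * K * √(2 * δ) := by fun_prop
      simpa using (this.tendsto 0).mono_left nhdsWithin_le_nhds
    have hs' : 0 < s / 2 := by positivity
    have h3 : ∀ᶠ δ : ℝ in 𝓝[>] 0, δ ∈ Ioc 0 (1 / 2) := Ioc_mem_nhdsGT (by norm_num)
    obtain ⟨δ, h1, h2, h3⟩ := ((t1.eventually_le_const hs').and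
      ((t2.eventually_le_const hs').and h3)).exists
    exact ⟨δ, h3.1, h3.2, h1, h2⟩
  refine ⟨δ, hδ, fun L hL => ?_⟩
  obtain ⟨ε₀, hε₀, h1, h2⟩ : ∃ ε₀ : ℝ, 0 < ε₀ ∧ ε₀ ^ 2 / 2 * L ^ 2 ≤ s / 2 ∧
      16 * ε₀ ^ 2 * τ ^ 2 < s / 2 / 2 * δ ^ 2 := by
    have t1 : Tendsto (fun e : ℝ => e ^ 2 / 2 * L ^ 2) (𝓝[>] 0) (𝓝 0) := by
      have : Continuous fun e : ℝ => e ^ 2 / 2 * L ^ 2 := by fun_prop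
      simpa using (this.tendsto 0).mono_left nhdsWithin_le_nhds
    have t2 : Tendsto (fun e : ℝ => 16 * e ^ 2 * τ ^ 2) (𝓝[>] 0) (𝓝 0) := by
      have : Continuous fun e : ℝ => 16 * e ^ 2 * τ ^ 2 := by fun_prop
      simpa using (this.tendsto 0).mono_left nhdsWithin_le_nhds
    obtain ⟨e, h1, h2, h3⟩ := ((t1.eventually_le_const (by positivity : 0 < s / 2)).and
      ((t2.eventually_lt_const (by positivity : 0 < s / 2 / 2 * δ ^ 2)).and
        self_mem_nhdsWithin)).exists
    exact ⟨e, h3, h1, h2⟩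
  refine ⟨ε₀, hε₀, fun ε r r' A g hε hlt h hR' x y hxy hyx hx hy => ?_⟩
  have hsq : ε ^ 2 ≤ ε₀ ^ 2 := by gcongr
  exact h.dichotomy hW hε hK hτ hτη hR' hδ1 (by linarith) hyx.le hs hs1 hs2
    (le_trans (by gcongr) h1) hx.le hy.le hτQ (lt_of_le_of_lt (by gcongr) h2) hgap

/-! ### A priori bounds for periodic profiles. -/

namespace IsProfile

variable {W : ℝ → ℝ} {ε K : ℝ} {r r' A g : ℝ → ℝ}

/-- Integrating the equation over a period removes the flux and gives the mean of `A`. Its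
oscillation is at most `∫ √r |g| ≤ ∫ (r + g²) / 2`, which uses only the mass, as no pointwise bound
on `r` is available yet. -/
lemma A_le_of_periodic (h : IsProfile W ε K r r' A g) (hW : IsPotential W) (hε : 0 < ε)
    (hper : Function.Periodic r 1) (hmass : ∫ x in (0 : ℝ)..1, r x = 1) {B : ℝ}
    (hB : ∫ x in (0 : ℝ)..1, (dQ W (r x) + 3 * ε ^ 2 / 2 * r' x ^ 2) ≤ B) {t : ℝ}
    (ht : t ∈ Icc (0 : ℝ) 1) : A t ≤ B + (1 + K ^ 2) / 2 := by
  have hdQ : Continuous fun x => dQ W (r x) :=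
    hW.continuousOn_dQ.comp_continuous h.continuous h.nonneg
  have hF : Continuous fun x => dQ W (r x) + 3 * ε ^ 2 / 2 * r' x ^ 2 :=
    hdQ.add (continuous_const.mul (h.continuous_deriv.pow 2))
  have hper' : r' 1 = r' 0 := by
    have h1 : HasDerivAt (fun s => r (s + 1)) (r' (0 + 1)) 0 :=
      HasDerivAt.comp_add_const 0 1 (h.hasDerivAt (0 + 1))
    have h2 : (fun s => r (s + 1)) = r := funext hper
    rw [h2, zero_add] at h1
    exact h1.unique (h.hasDerivAt 0)
  have hr1 : r 1 = r 0 := by simpa using hper 0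
  have hmean : ∫ x in (0 : ℝ)..1, A x =
      ∫ x in (0 : ℝ)..1, (dQ W (r x) + 3 * ε ^ 2 / 2 * r' x ^ 2) := by
    have h1 := intervalIntegral.integral_eq_sub_of_hasDerivAt (a := 0) (b := 1)
      (fun x _ => h.hasDerivAt_flux x)
      (((hF.sub h.continuous_A).div_const _).intervalIntegrable _ _)
    rw [hr1, hper', sub_self, intervalIntegral.integral_div, intervalIntegral.integral_sub
      (hF.intervalIntegrable _ _) (h.continuous_A.intervalIntegrable _ _)] at h1
    have hε2 : ε ^ 2 ≠ 0 := by positivity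
    rw [div_eq_zero_iff] at h1
    have := h1.resolve_right hε2
    linarith
  have hosc : ∀ s ∈ Icc (0 : ℝ) 1, A t - (1 + K ^ 2) / 2 ≤ A s := fun s hs => by
    have i1 := h.intervalIntegrable_sqrt_mul 0 1
    have i2 := (h.continuous.intervalIntegrable 0 1).add (h.intervalIntegrable_sq 0 1)
    have h1 : |A t - A s| ≤ ∫ x in (0 : ℝ)..1, |√(r x) * g x| := by
      rw [h.sub_eq, ← Real.norm_eq_abs]
      refine intervalIntegral.norm_integral_le_integral_norm_uIoc.trans ?_
      rw [intervalIntegral.integral_of_le zero_le_one]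
      refine setIntegral_mono_set i1.norm.1 (Eventually.of_forall fun x => norm_nonneg _)
        (LE.le.eventuallyLE ?_)
      rw [uIoc]
      exact Ioc_subset_Ioc (le_inf hs.1 ht.1) (sup_le hs.2 ht.2)
    have h2 : ∫ x in (0 : ℝ)..1, |√(r x) * g x| ≤ ∫ x in (0 : ℝ)..1, (r x + g x ^ 2) / 2 := by
      refine intervalIntegral.integral_mono_on zero_le_one i1.abs (i2.div_const 2) fun x _ => ?_
      rw [abs_mul, abs_of_nonneg (Real.sqrt_nonneg _)]
      have := two_mul_le_add_sq (√(r x)) |g x|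
      rw [Real.sq_sqrt (h.nonneg x), sq_abs] at this
      linarith
    rw [intervalIntegral.integral_div, intervalIntegral.integral_add
      (h.continuous.intervalIntegrable 0 1) (h.intervalIntegrable_sq 0 1), hmass] at h2
    have h3 := h.integral_sq_le 0 1 zero_le_one (by simp)
    linarith [(abs_le.1 (h1.trans h2)).2]
  have : ∫ _ in (0 : ℝ)..1, (A t - (1 + K ^ 2) / 2) ≤ ∫ s in (0 : ℝ)..1, A s :=
    intervalIntegral.integral_mono_on zero_le_one intervalIntegrable_const
      (h.continuous_A.intervalIntegrable 0 1) hosc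
  rw [intervalIntegral.integral_const, sub_zero, one_smul, hmean] at this
  linarith

/-- At a global maximum `dQ(r) ≤ A ≤ M`, which excludes values above `R`. -/
lemma le_of_periodic (h : IsProfile W ε K r r' A g) (hε : 0 < ε)
    (hper : Function.Periodic r 1) {M R : ℝ} (hA : ∀ t ∈ Icc (0 : ℝ) 1, A t ≤ M) (hR : 0 ≤ R)
    (hMR : ∀ q, R < q → M < dQ W q) (t : ℝ) : r t ≤ R := by
  obtain ⟨c, hc, hmax⟩ := isCompact_Icc.exists_isMaxOn (nonempty_Icc.2 (zero_le_one' ℝ))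
    h.continuous.continuousOn
  have hglob : ∀ t, r t ≤ r c := fun t => by
    obtain ⟨y, hy, hty⟩ := hper.exists_mem_Ico₀ one_pos t
    rw [hty]
    exact hmax (Ico_subset_Icc_self hy)
  refine (hglob t).trans ?_
  by_contra! hlt
  have := h.dQ_le_of_isLocalMax hε (hR.trans_lt hlt) (Eventually.of_forall hglob)
  linarith [hA c hc, hMR _ hlt]

end IsProfile

/-! ### Distributions on the circle via Fourier series. -/

lemma torusDeriv_coe (f : UnitAddCircle → ℝ) (t : ℝ) :
    torusDeriv f t = deriv (fun s : ℝ => f s) t := by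
  have := deriv_comp_const_add (fun s : ℝ => f s) t 0
  simp only [AddCircle.coe_add, add_zero] at this
  exact this

lemma integral_unitAddCircle (f : UnitAddCircle → ℝ) : ∫ x, f x = ∫ t in (0 : ℝ)..1, f t := by
  rw [← UnitAddCircle.intervalIntegral_preimage 0 f, zero_add]

lemma periodic_comp_coe {E : Type*} (f : UnitAddCircle → E) :
    Function.Periodic (fun t : ℝ => f t) 1 := fun t => by
  simp only
  rw [AddCircle.coe_add_period]

lemma exists_unitAddCircle_lift {f : ℝ → ℝ} (hf : Continuous f) (hp : Function.Periodic f 1) :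
    ∃ F : UnitAddCircle → ℝ, Continuous F ∧ ∀ t : ℝ, F t = f t :=
  ⟨hp.lift, (QuotientAddGroup.isQuotientMap_mk
    (N := AddSubgroup.zmultiples (1 : ℝ))).continuous_iff.2 hf, fun _ => rfl⟩

lemma TorusContDiff.continuous {n : ℕ∞} {f : UnitAddCircle → ℝ} (hf : TorusContDiff n f) :
    Continuous f :=
  (QuotientAddGroup.isQuotientMap_mk (N := AddSubgroup.zmultiples (1 : ℝ))).continuous_iff.2
    (ContDiff.continuous hf)

/-- A real `L²` function on the circle with vanishing Fourier coefficients vanishes. -/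
lemma ae_eq_zero_of_forall_integral_cos_sin {u : UnitAddCircle → ℝ} (hu : MemLp u 2)
    (hc : ∀ n : ℤ, ∫ t in (0 : ℝ)..1, u t * Real.cos (2 * Real.pi * n * t) = 0)
    (hs : ∀ n : ℤ, ∫ t in (0 : ℝ)..1, u t * Real.sin (2 * Real.pi * n * t) = 0) :
    u =ᵐ[volume] 0 := by
  have hvol : (volume : Measure UnitAddCircle) = AddCircle.haarAddCircle := by
    rw [AddCircle.volume_eq_smul_haarAddCircle]; simp
  have hu' : MemLp (fun x => (u x : ℂ)) 2 AddCircle.haarAddCircle := by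
    rw [memLp_haarAddCircle_iff]; exact hu.ofReal
  have hint : IntervalIntegrable (fun t : ℝ => u t) volume 0 1 := by
    rw [intervalIntegrable_iff_integrableOn_Ioc_of_le zero_le_one]
    have := (UnitAddCircle.measurePreserving_mk 0).integrable_comp_of_integrable
      (hu.integrable (by norm_num))
    rwa [zero_add] at this
  have hcoeff : ∀ n, fourierCoeff (fun x => (u x : ℂ)) n = 0 := fun n => by
    rw [fourierCoeff_eq_intervalIntegral _ _ 0, zero_add]
    have e : ∀ t : ℝ, (fourier (-n) (t : UnitAddCircle) : ℂ) • (u t : ℂ) =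
        ((u t * Real.cos (2 * Real.pi * n * t) : ℝ) : ℂ) -
          Complex.I * ((u t * Real.sin (2 * Real.pi * n * t) : ℝ) : ℂ) := fun t => by
      rw [fourier_coe_apply]
      have : 2 * (Real.pi : ℂ) * Complex.I * ((-n : ℤ) : ℂ) * (t : ℂ) / ((1 : ℝ) : ℂ) =
          ((-(2 * Real.pi * n * t) : ℝ) : ℂ) * Complex.I := by push_cast; ring
      rw [this, Complex.exp_mul_I, ← Complex.ofReal_cos, ← Complex.ofReal_sin, Real.cos_neg,
        Real.sin_neg, smul_eq_mul]
      push_cast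
      ring
    simp_rw [e]
    have ic : IntervalIntegrable (fun t : ℝ => u t * Real.cos (2 * Real.pi * n * t)) volume 0 1 :=
      hint.mul_continuousOn (by fun_prop)
    have is : IntervalIntegrable (fun t : ℝ => u t * Real.sin (2 * Real.pi * n * t)) volume 0 1 :=
      hint.mul_continuousOn (by fun_prop)
    have icC : IntervalIntegrable (fun t : ℝ => ((u t * Real.cos (2 * Real.pi * n * t) : ℝ) : ℂ))
        volume 0 1 := ⟨ic.1.ofReal, ic.2.ofReal⟩
    have isC : IntervalIntegrable (fun t : ℝ => ((u t * Real.sin (2 * Real.pi * n * t) : ℝ) : ℂ))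
        volume 0 1 := ⟨is.1.ofReal, is.2.ofReal⟩
    rw [intervalIntegral.integral_sub icC (isC.const_mul _),
      intervalIntegral.integral_const_mul, intervalIntegral.integral_ofReal,
      intervalIntegral.integral_ofReal, hc, hs]
    simp
  have h0 : hu'.toLp = 0 := by
    refine (fourierBasis (T := 1)).repr.injective ?_
    ext n
    rw [fourierBasis_repr, fourierCoeff_congr_ae hu'.coeFn_toLp, hcoeff]
    simp
  have h1 := hu'.coeFn_toLp
  rw [h0] at h1
  rw [hvol]
  filter_upwards [h1, Lp.coeFn_zero ℂ 2 (AddCircle.haarAddCircle (T := 1))] with x hx1 hx2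
  rw [hx2] at hx1
  simpa using hx1.symm

lemma ae_eq_zero_of_forall_integral_mul {u : UnitAddCircle → ℝ} (hu : MemLp u 2)
    (h : ∀ φ, TorusContDiff ⊤ φ → ∫ x, u x * φ x = 0) : u =ᵐ[volume] 0 := by
  have key : ∀ f : ℝ → ℝ, ContDiff ℝ ∞ f → Function.Periodic f 1 →
      ∫ t in (0 : ℝ)..1, u t * f t = 0 := fun f hf hp => by
    obtain ⟨F, -, hF⟩ := exists_unitAddCircle_lift hf.continuous hp
    have := h F (by simpa only [TorusContDiff, hF] using hf)
    rw [integral_unitAddCircle] at this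
    simpa only [hF] using this
  refine ae_eq_zero_of_forall_integral_cos_sin hu (fun n => ?_) fun n => ?_
  · refine key _ (by fun_prop) fun t => ?_
    rw [show 2 * Real.pi * n * (t + 1) = 2 * Real.pi * n * t + n * (2 * Real.pi) by ring,
      Real.cos_add_int_mul_two_pi]
  · refine key _ (by fun_prop) fun t => ?_
    rw [show 2 * Real.pi * n * (t + 1) = 2 * Real.pi * n * t + n * (2 * Real.pi) by ring,
      Real.sin_add_int_mul_two_pi]

/-- A continuous periodic function whose integrals against second derivatives of smooth periodic
functions vanish is constant. -/
lemma eq_const_of_forall_integral_mul_deriv_deriv {v : ℝ → ℝ} (hv : Continuous v)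
    (hp : Function.Periodic v 1)
    (h : ∀ f : ℝ → ℝ, ContDiff ℝ ∞ f → Function.Periodic f 1 →
      ∫ t in (0 : ℝ)..1, v t * deriv (deriv f) t = 0) : ∃ m, ∀ t, v t = m := by
  set m := ∫ t in (0 : ℝ)..1, v t with hm
  obtain ⟨u, hu, huv⟩ := exists_unitAddCircle_lift (f := fun t => v t - m)
    (hv.sub continuous_const) fun t => by simp [hp t]
  -- An eigenfunction of the second derivative with eigenvalue `c ≠ 0` is itself a second derivative
  -- up to a factor, so it is orthogonal to `v` and to constants. The zero mode is handled by
  -- subtracting the mean.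
  have key : ∀ f g : ℝ → ℝ, ∀ c : ℝ, c ≠ 0 → ContDiff ℝ ∞ f → Function.Periodic f 1 →
      (∀ t, HasDerivAt f (g t) t) → (∀ t, HasDerivAt g (c * f t) t) →
      ∫ t in (0 : ℝ)..1, u t * f t = 0 := fun f g c hc hf hpf hd1 hd2 => by
    have e1 : deriv f = g := funext fun t => (hd1 t).deriv
    have e2 : deriv (deriv f) = fun t => c * f t := by rw [e1]; exact funext fun t => (hd2 t).deriv
    have h1 := h f hf hpf
    have hg1 : g 1 = g 0 := by
      have h1 : HasDerivAt (fun s => f (s + 1)) (g (0 + 1)) 0 :=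
        HasDerivAt.comp_add_const 0 1 (hd1 (0 + 1))
      rw [show (fun s => f (s + 1)) = f from funext hpf, zero_add] at h1
      exact h1.unique (hd1 0)
    have h2 := intervalIntegral.integral_eq_sub_of_hasDerivAt (a := 0) (b := 1)
      (fun t _ => hd2 t) ((continuous_const.fun_mul hf.continuous).intervalIntegrable _ _)
    rw [e2] at h1
    simp only [huv, sub_mul]
    rw [intervalIntegral.integral_sub ((hv.fun_mul hf.continuous).intervalIntegrable _ _)
      ((continuous_const.fun_mul hf.continuous).intervalIntegrable _ _),
      intervalIntegral.integral_const_mul]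
    rw [intervalIntegral.integral_const_mul, hg1, sub_self] at h2
    have h3 : c * ∫ t in (0 : ℝ)..1, v t * f t = 0 := by
      rw [← intervalIntegral.integral_const_mul]
      refine Eq.trans (intervalIntegral.integral_congr fun t _ => ?_) h1
      simp only
      ring
    rw [(mul_eq_zero.1 h2).resolve_left hc, (mul_eq_zero.1 h3).resolve_left hc]
    simp
  have hu0 : ∫ t in (0 : ℝ)..1, u t = 0 := by
    simp only [huv]
    rw [intervalIntegral.integral_sub (hv.intervalIntegrable _ _) intervalIntegrable_const]
    simp [hm]
  have hae : u =ᵐ[volume] 0 := by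
    refine ae_eq_zero_of_forall_integral_cos_sin
      (hu.memLp_of_hasCompactSupport (HasCompactSupport.of_compactSpace u))
      (fun n => ?_) fun n => ?_
    all_goals
      rcases eq_or_ne n 0 with rfl | hn
      · simp [hu0]
      have hw : 2 * Real.pi * n ≠ 0 := mul_ne_zero Real.two_pi_pos.ne' (Int.cast_ne_zero.2 hn)
      set w := 2 * Real.pi * n with hwd
      have hlin : ∀ t, HasDerivAt (fun t : ℝ => w * t) w t := fun t => by
        simpa using (hasDerivAt_id t).const_mul w
      have hper : ∀ t : ℝ, w * (t + 1) = w * t + n * (2 * Real.pi) := fun t => by rw [hwd]; ring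
    · refine key _ (fun t => - (w * Real.sin (w * t))) (-(w ^ 2)) (by simpa using hw) (by fun_prop)
        (fun t => by rw [hper, Real.cos_add_int_mul_two_pi])
        (fun t => (hlin t).cos.congr_deriv (by ring))
        fun t => ((hlin t).sin.const_mul w).neg.congr_deriv (by ring)
    · refine key _ (fun t => w * Real.cos (w * t)) (-(w ^ 2)) (by simpa using hw) (by fun_prop)
        (fun t => by rw [hper, Real.sin_add_int_mul_two_pi])
        (fun t => (hlin t).sin.congr_deriv (by ring))
        fun t => ((hlin t).cos.const_mul w).congr_deriv (by ring)
  have := (Continuous.ae_eq_iff_eq _ hu continuous_zero).1 hae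
  refine ⟨m, fun t => ?_⟩
  have h1 := congrFun this (t : UnitAddCircle)
  rw [huv] at h1
  simpa [sub_eq_zero] using h1

lemma periodic_deriv {f f' : ℝ → ℝ} (hp : Function.Periodic f 1)
    (hd : ∀ t, HasDerivAt f (f' t) t) : Function.Periodic f' 1 := fun t => by
  have h1 : HasDerivAt (fun s => f (s + 1)) (f' (t + 1)) t :=
    HasDerivAt.comp_add_const t 1 (hd (t + 1))
  rw [show (fun s => f (s + 1)) = f from funext hp] at h1
  exact h1.unique (hd t)

lemma periodic_primitive {f : ℝ → ℝ} (hp : Function.Periodic f 1)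
    (hi : ∀ a b, IntervalIntegrable f volume a b) (h0 : ∫ x in (0 : ℝ)..1, f x = 0) :
    Function.Periodic (fun t => ∫ x in (0 : ℝ)..t, f x) 1 := fun t => by
  have h1 := hp.intervalIntegral_add_eq t 0
  rw [zero_add, h0] at h1
  have h2 := intervalIntegral.integral_add_adjacent_intervals (hi 0 t) (hi t (t + 1))
  simp only
  rw [← h2, h1, add_zero]

/-- If `k' = f` weakly on the circle up to a constant, then `k` is differentiable with derivative
`f` up to a constant. -/
lemma hasDerivAt_of_forall_integral {f k : ℝ → ℝ} (hf : Continuous f) (hk : Continuous k)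
    (hpf : Function.Periodic f 1) (hpk : Function.Periodic k 1)
    (h : ∀ φ : ℝ → ℝ, ContDiff ℝ ∞ φ → Function.Periodic φ 1 →
      (∫ t in (0 : ℝ)..1, f t * deriv φ t) + ∫ t in (0 : ℝ)..1, k t * deriv (deriv φ) t = 0) :
    ∃ c, ∀ t, HasDerivAt k (f t - c) t := by
  -- Subtracting the mean makes the primitive `F` periodic; then `k - F` is orthogonal to all second
  -- derivatives and hence constant.
  set c := ∫ t in (0 : ℝ)..1, f t with hc
  set F := fun t => ∫ x in (0 : ℝ)..t, (f x - c) with hF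
  have hfc : Continuous fun x => f x - c := hf.sub continuous_const
  have hFd : ∀ t, HasDerivAt F (f t - c) t := fun t =>
    hfc.integral_hasStrictDerivAt 0 t |>.hasDerivAt
  have hF1 : ∫ x in (0 : ℝ)..1, (f x - c) = 0 := by
    rw [intervalIntegral.integral_sub (hf.intervalIntegrable _ _) intervalIntegrable_const]
    simp [hc]
  have hFp : Function.Periodic F 1 := periodic_primitive (fun t => by simp [hpf t])
    (fun a b => hfc.intervalIntegrable a b) hF1
  have hFc : Continuous F := continuous_iff_continuousAt.2 fun t => (hFd t).continuousAt
  obtain ⟨m, hm⟩ := eq_const_of_forall_integral_mul_deriv_deriv (v := fun t => k t - F t)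
    (hk.sub hFc) (fun t => by simp only; rw [hpk t, hFp t]) fun φ hφ hpφ => by
      have hφ1 : ContDiff ℝ ∞ (deriv φ) := (contDiff_infty_iff_deriv.1 hφ).2
      have hφ2 : ContDiff ℝ ∞ (deriv (deriv φ)) := (contDiff_infty_iff_deriv.1 hφ1).2
      have hd1 : ∀ t, HasDerivAt φ (deriv φ t) t := fun t =>
        (hφ.differentiable (by simp) t).hasDerivAt
      have hd2 : ∀ t, HasDerivAt (deriv φ) (deriv (deriv φ) t) t := fun t =>
        (hφ1.differentiable (by simp) t).hasDerivAt
      have hp1 := periodic_deriv hpφ hd1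
      have e1 := intervalIntegral.integral_eq_sub_of_hasDerivAt (a := 0) (b := 1)
        (fun t _ => hd1 t) (hφ1.continuous.intervalIntegrable _ _)
      have e2 := intervalIntegral.integral_deriv_mul_eq_sub (a := 0) (b := 1)
        (fun t _ => hFd t) (fun t _ => hd2 t) (hfc.intervalIntegrable _ _)
        (hφ2.continuous.intervalIntegrable _ _)
      have b1 : φ 1 = φ 0 := by simpa using hpφ 0
      have b2 : deriv φ 1 = deriv φ 0 := by simpa using hp1 0
      have b3 : F 1 = F 0 := by simpa using hFp 0
      rw [b1, sub_self] at e1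
      rw [b2, b3, sub_self, intervalIntegral.integral_add
        ((hfc.fun_mul hφ1.continuous).intervalIntegrable _ _)
        ((hFc.fun_mul hφ2.continuous).intervalIntegrable _ _)] at e2
      simp only [sub_mul] at e2 ⊢
      rw [intervalIntegral.integral_sub ((hf.fun_mul hφ1.continuous).intervalIntegrable _ _)
        ((continuous_const.fun_mul hφ1.continuous).intervalIntegrable _ _),
        intervalIntegral.integral_const_mul, e1] at e2
      rw [intervalIntegral.integral_sub ((hk.fun_mul hφ2.continuous).intervalIntegrable _ _)
        ((hFc.fun_mul hφ2.continuous).intervalIntegrable _ _)]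
      linarith [h φ hφ hpφ]
  refine ⟨c, fun t => ?_⟩
  have : k = fun t => m + F t := funext fun t => by rw [← hm t]; ring
  rw [this]
  exact (hFd t).const_add m

/-! ### From weak to classical derivatives in the energy and the slope. -/

lemma weakDeriv_spec {u : UnitAddCircle → ℝ} (h : MemH1 u) :
    MemLp (weakDeriv u) 2 ∧ HasWeakDeriv u (weakDeriv u) := by
  rw [weakDeriv, dif_pos h]
  exact h.2.choose_spec

lemma memLp_of_continuous {u : UnitAddCircle → ℝ} (hu : Continuous u)
    (p : ENNReal) : MemLp u p :=
  hu.memLp_of_hasCompactSupport (HasCompactSupport.of_compactSpace u)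

lemma TorusContDiff.hasDerivAt {u : UnitAddCircle → ℝ} {n : ℕ∞} (hn : 1 ≤ n)
    (hu : TorusContDiff n u) (t : ℝ) :
    HasDerivAt (fun s : ℝ => u s) (torusDeriv u t) t := by
  rw [torusDeriv_coe]
  refine (ContDiff.differentiable hu ?_ t).hasDerivAt
  exact_mod_cast (zero_lt_one.trans_le hn).ne'

lemma TorusContDiff.continuous_torusDeriv_coe {u : UnitAddCircle → ℝ} {n : ℕ∞} (hn : 1 ≤ n)
    (hu : TorusContDiff n u) : Continuous fun t : ℝ => torusDeriv u t := by
  simp only [torusDeriv_coe]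
  exact ContDiff.continuous_deriv hu (by exact_mod_cast hn)

lemma continuous_of_continuous_coe {u : UnitAddCircle → ℝ} (hu : Continuous fun t : ℝ => u t) :
    Continuous u :=
  (QuotientAddGroup.isQuotientMap_mk (N := AddSubgroup.zmultiples (1 : ℝ))).continuous_iff.2 hu

lemma TorusContDiff.torusDeriv {u : UnitAddCircle → ℝ} (hu : TorusContDiff ⊤ u) :
    TorusContDiff ⊤ (torusDeriv u) := by
  simp only [TorusContDiff, torusDeriv_coe]
  exact (contDiff_infty_iff_deriv.1 hu).2

lemma integral_torusDeriv_mul {u φ : UnitAddCircle → ℝ} (hu : TorusContDiff 1 u)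
    (hφ : TorusContDiff ⊤ φ) :
    ∫ x, u x * torusDeriv φ x = - ∫ x, torusDeriv u x * φ x := by
  rw [integral_unitAddCircle, integral_unitAddCircle]
  have h := intervalIntegral.integral_mul_deriv_eq_deriv_mul (a := 0) (b := 1)
    (fun t _ => hu.hasDerivAt le_rfl t) (fun t _ => hφ.hasDerivAt le_top t)
    ((hu.continuous_torusDeriv_coe le_rfl).intervalIntegrable _ _)
    ((hφ.continuous_torusDeriv_coe le_top).intervalIntegrable _ _)
  have h1 : (((1 : ℝ) : ℝ) : UnitAddCircle) = ((0 : ℝ) : UnitAddCircle) := by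
    simp
  rw [h1, sub_self, zero_sub] at h
  exact h

lemma weakDeriv_ae_eq {u : UnitAddCircle → ℝ} (h : MemH1 u) (hu : TorusContDiff 1 u) :
    weakDeriv u =ᵐ[volume] torusDeriv u := by
  obtain ⟨h1, h2⟩ := weakDeriv_spec h
  have hc := continuous_of_continuous_coe (hu.continuous_torusDeriv_coe le_rfl)
  have h3 := memLp_of_continuous hc 2
  have := ae_eq_zero_of_forall_integral_mul (h1.sub h3) fun φ hφ => by
    have hφ2 := memLp_of_continuous hφ.continuous 2
    simp only [Pi.sub_apply, sub_mul]
    have i1 : Integrable fun x => weakDeriv u x * φ x := h1.integrable_mul hφ2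
    have i2 : Integrable fun x => torusDeriv u x * φ x := h3.integrable_mul hφ2
    rw [integral_sub i1 i2]
    have e1 := h2 φ hφ
    rw [integral_torusDeriv_mul hu hφ] at e1
    linarith
  filter_upwards [this] with x hx
  simpa [sub_eq_zero] using hx

lemma Gdist_eq {W : ℝ → ℝ} {ε : ℝ} {u : UnitAddCircle → ℝ} (h : MemH1 u)
    (hu : TorusContDiff 1 u) (φ : UnitAddCircle → ℝ) :
    Gdist W ε u φ = (∫ t in (0 : ℝ)..1, (dQ W (u t) + 3 * ε ^ 2 / 2 * torusDeriv u t ^ 2) * φ t)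
      + ε ^ 2 * ∫ t in (0 : ℝ)..1, u t * torusDeriv u t * torusDeriv φ t := by
  have hae := weakDeriv_ae_eq h hu
  rw [Gdist, ← integral_unitAddCircle
    (fun x => (dQ W (u x) + 3 * ε ^ 2 / 2 * torusDeriv u x ^ 2) * φ x),
    ← integral_unitAddCircle (fun x => u x * torusDeriv u x * torusDeriv φ x)]
  congr 1
  · refine integral_congr_ae ?_
    filter_upwards [hae] with x hx
    rw [hx]
  · congr 1
    refine integral_congr_ae ?_
    filter_upwards [hae] with x hx
    rw [hx]

lemma integral_le_of_energy_le {W : ℝ → ℝ} (hW : IsPotential W) {ε : ℝ} {C : NNReal}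
    {u : UnitAddCircle → ℝ} (h : MemH1 u) (h0 : ∀ x, 0 ≤ u x) (hu : TorusContDiff 1 u)
    (hE : energy W ε u ≤ C) :
    ∫ t in (0 : ℝ)..1, (ε ^ 2 / 2 * torusDeriv u t ^ 2 + W (u t)) ≤ (C : ℝ) := by
  have hc := continuous_of_continuous_coe (hu.continuous_torusDeriv_coe le_rfl)
  have hcW : Continuous fun x => W (u x) := hW.continuousOn.comp_continuous hu.continuous h0
  have hF : Continuous fun x => ε ^ 2 / 2 * torusDeriv u x ^ 2 + W (u x) :=
    (continuous_const.mul (hc.pow 2)).add hcW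
  rw [← integral_unitAddCircle (fun x => ε ^ 2 / 2 * torusDeriv u x ^ 2 + W (u x))]
  have e : energy W ε u = ∫⁻ x, ENNReal.ofReal (ε ^ 2 / 2 * torusDeriv u x ^ 2 + W (u x)) := by
    rw [energy, if_pos h]
    refine lintegral_congr_ae ?_
    filter_upwards [weakDeriv_ae_eq h hu] with x hx
    rw [hx]
  rw [e, ← ofReal_integral_eq_lintegral_ofReal
    ((memLp_of_continuous hF 1).integrable le_rfl)
    (Eventually.of_forall fun x => add_nonneg (by positivity) (hW.nonneg _ (h0 x)))] at hE
  rw [← ENNReal.ofReal_coe_nnreal] at hE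
  exact (ENNReal.ofReal_le_ofReal_iff C.2).1 hE

lemma integral_sq_le_of_eLpNorm_le {g : UnitAddCircle → ℝ} (hg : MemLp g 2) {K : ℝ} (hK : 0 ≤ K)
    (h : eLpNorm g 2 volume ≤ ENNReal.ofReal K) : ∫ x, g x ^ 2 ≤ K ^ 2 := by
  rw [hg.eLpNorm_eq_integral_rpow_norm (by norm_num) (by norm_num),
    ENNReal.ofReal_le_ofReal_iff hK] at h
  simp only [ENNReal.toReal_ofNat, Real.rpow_ofNat, Real.norm_eq_abs, sq_abs] at h
  have h0 : 0 ≤ ∫ x, g x ^ 2 := integral_nonneg fun x => sq_nonneg _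
  rw [← one_div, ← Real.sqrt_eq_rpow] at h
  exact (Real.sqrt_le_left hK).1 h

lemma intervalIntegrable_coe {f : UnitAddCircle → ℝ} (hf : Integrable f) (a b : ℝ) :
    IntervalIntegrable (fun t : ℝ => f t) volume a b := by
  refine (periodic_comp_coe f).intervalIntegrable₀ one_ne_zero ?_ a b
  rw [intervalIntegrable_iff_integrableOn_Ioc_of_le zero_le_one]
  have := (UnitAddCircle.measurePreserving_mk 0).integrable_comp_of_integrable hf
  rwa [zero_add] at this

/-- A density of class `C¹` with finite slope is a profile. -/
theorem exists_isProfile {W : ℝ → ℝ} (hW : IsPotential W) {ε : ℝ} (hε : 0 < ε) {K : ℝ}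
    (hK : 0 ≤ K) {u g : UnitAddCircle → ℝ} (h0 : ∀ x, 0 ≤ u x) (hu : TorusContDiff 1 u)
    (hg : g ∈ Tset W ε u) (hgK : eLpNorm g 2 volume ≤ ENNReal.ofReal K) :
    ∃ A : ℝ → ℝ, IsProfile W ε K (fun t => u t) (fun t => torusDeriv u t) A (fun t => g t) := by
  obtain ⟨hH1, hg2, hweak⟩ := hg
  have hg1 : Integrable g := hg2.integrable (by norm_num)
  have hcu : Continuous fun t : ℝ => u t := ContDiff.continuous hu
  have hcd := hu.continuous_torusDeriv_coe le_rfl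
  have hcs : Continuous fun t : ℝ => √(u t) := hcu.sqrt
  have hiG : ∀ a b, IntervalIntegrable (fun t : ℝ => √(u t) * g t) volume a b := fun a b =>
    (intervalIntegrable_coe hg1 a b).continuousOn_mul hcs.continuousOn
  have hpG : Function.Periodic (fun t : ℝ => √(u t) * g t) 1 :=
    periodic_comp_coe fun x => √(u x) * g x
  have hd0 : torusDeriv (fun _ => (1 : ℝ)) = fun _ => 0 := by ext x; simp [torusDeriv]
  have hd00 : torusDeriv (fun _ => (0 : ℝ)) = fun _ => 0 := by ext x; simp [torusDeriv]
  -- Testing with the constant `1` shows that `√u g` has mean zero, so its primitive `N` is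
  -- periodic.
  have hG0 : ∫ t in (0 : ℝ)..1, √(u t) * g t = 0 := by
    have := hweak (fun _ => 1) (by simpa [TorusContDiff] using contDiff_const)
    rw [hd0, Gdist_eq hH1 hu, hd00, integral_unitAddCircle] at this
    simpa using this.symm
  set N := fun t : ℝ => ∫ x in (0 : ℝ)..t, √(u x) * g x with hN
  have hpN : Function.Periodic N 1 := periodic_primitive hpG hiG hG0
  have hcN : Continuous N := intervalIntegral.continuous_primitive hiG 0
  have hcQ : Continuous fun t : ℝ => dQ W (u t) :=
    hW.continuousOn_dQ.comp_continuous hcu fun t => h0 _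
  have hcF : Continuous fun t : ℝ => dQ W (u t) + 3 * ε ^ 2 / 2 * torusDeriv u t ^ 2 :=
    hcQ.add (continuous_const.mul (hcd.pow 2))
  obtain ⟨c, hc⟩ := hasDerivAt_of_forall_integral
    (f := fun t : ℝ => dQ W (u t) + 3 * ε ^ 2 / 2 * torusDeriv u t ^ 2 - N t)
    (k := fun t : ℝ => ε ^ 2 * (u t * torusDeriv u t)) (hcF.sub hcN)
    (continuous_const.mul (hcu.mul hcd))
    (fun t => by
      have h1 := periodic_comp_coe (fun x => dQ W (u x) + 3 * ε ^ 2 / 2 * torusDeriv u x ^ 2) t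
      simp only at h1 ⊢
      rw [hpN t, h1])
    (periodic_comp_coe fun x => ε ^ 2 * (u x * torusDeriv u x))
    (fun f hf hpf => by
      obtain ⟨φ, -, hφ⟩ := exists_unitAddCircle_lift hf.continuous hpf
      have hφc : TorusContDiff ⊤ φ := by simpa only [TorusContDiff, hφ] using hf
      have e1 : ∀ t : ℝ, torusDeriv φ t = deriv f t := fun t => by
        rw [torusDeriv_coe]; simp only [hφ]
      have e2 : ∀ t : ℝ, torusDeriv (torusDeriv φ) t = deriv (deriv f) t := fun t => by
        rw [torusDeriv_coe]; simp only [e1]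
      have hf1 : ContDiff ℝ ∞ (deriv f) := (contDiff_infty_iff_deriv.1 hf).2
      have hd : ∀ t, HasDerivAt f (deriv f t) t := fun t =>
        (hf.differentiable (by simp) t).hasDerivAt
      have h1 := hweak φ hφc
      rw [Gdist_eq hH1 hu, integral_unitAddCircle] at h1
      simp only [e1, e2, hφ] at h1
      have h2 := integral_parts_of_primitive (s := 0) (t := 1) (hiG 0 1)
        (hf1.continuous.intervalIntegrable 0 1) (F₁ := N) (F₂ := f)
        (fun x _ => by simp [hN])
        (fun x _ => (intervalIntegral.integral_eq_sub_of_hasDerivAt (fun y _ => hd y)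
          (hf1.continuous.intervalIntegrable _ _)).symm)
      have hN0 : N 0 = 0 := by simp [hN]
      have hN1 : N 1 = 0 := hG0
      rw [hN0, hN1, zero_mul, zero_mul, sub_zero, intervalIntegral.integral_add
        ((hiG 0 1).mul_continuousOn hf.continuous.continuousOn)
        ((hcN.fun_mul hf1.continuous).intervalIntegrable _ _)] at h2
      simp only [sub_mul, mul_assoc] at h1 h2 ⊢
      rw [intervalIntegral.integral_sub ((hcF.fun_mul hf1.continuous).intervalIntegrable _ _)
        ((hcN.fun_mul hf1.continuous).intervalIntegrable _ _),
        intervalIntegral.integral_const_mul]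
      linarith)
  -- The constant `c` left undetermined by the weak equation is absorbed into `A`.
  refine ⟨fun t => N t + c, fun t => h0 _, hu.hasDerivAt le_rfl, hcd, fun t => ?_, fun s t => ?_,
    intervalIntegrable_coe hg1, intervalIntegrable_coe hg2.integrable_sq, fun s t hst hts => ?_⟩
  · have hε2 : ε ^ 2 ≠ 0 := by positivity
    have h1 := (hc t).div_const (ε ^ 2)
    refine (h1.congr_of_eventuallyEq (Eventually.of_forall fun s => ?_)).congr_deriv ?_
    · field_simp
    · ring
  · rw [← intervalIntegral.integral_interval_sub_left (hiG 0 t) (hiG 0 s)]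
    simp only [hN]
    ring
  · refine le_trans ?_ (integral_sq_le_of_eLpNorm_le hg2 hK hgK)
    rw [← UnitAddCircle.intervalIntegral_preimage s]
    exact intervalIntegral.integral_mono_interval le_rfl hst hts
      (Eventually.of_forall fun x => sq_nonneg _) (intervalIntegrable_coe hg2.integrable_sq _ _)

/-- Bound for the densities with `E^ε + 𝒢^ε ≤ C`, and the associated profile. -/
theorem IsPotential.exists_profile_bound {W : ℝ → ℝ} (hW : IsPotential W) (C : NNReal) :
    ∃ R : ℝ, ∀ (ε : ℝ) (u : UnitAddCircle → ℝ), 0 < ε → IsProbDensity u → TorusContDiff 1 u →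
      energy W ε u + slope W ε u ≤ C →
      (∀ x, u x ≤ R) ∧ ∃ A g : ℝ → ℝ,
        IsProfile W ε (C + 1) (fun t => u t) (fun t => torusDeriv u t) A g := by
  obtain ⟨c, hc, hgrow⟩ := hW.growth
  set M : ℝ := c + (c + 3) * C + (1 + ((C : ℝ) + 1) ^ 2) / 2
  obtain ⟨R, hR⟩ := (hW.tendsto_dQ.eventually_gt_atTop M).exists_forall_of_atTop
  refine ⟨max R 0, fun ε u hε hu hu1 hle => ?_⟩
  have hE : energy W ε u ≤ C := le_self_add.trans hle
  -- The infimum defining the slope need not be attained; the margin `1` provides an admissible `g`,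
  -- and also makes `K = C + 1` positive when `C = 0`.
  have hS : slope W ε u < ENNReal.ofReal ((C : ℝ) + 1) := by
    refine lt_of_le_of_lt (le_add_self.trans hle) ?_
    rw [← ENNReal.ofReal_coe_nnreal]
    exact (ENNReal.ofReal_lt_ofReal_iff (by positivity)).2 (by linarith)
  rw [slope] at hS
  simp only [iInf_lt_iff] at hS
  obtain ⟨g, hgT, hgC⟩ := hS
  obtain ⟨A, hP⟩ := exists_isProfile hW hε (by positivity) hu.nonneg hu1 hgT hgC.le
  refine ⟨?_, A, _, hP⟩
  have hEint := integral_le_of_energy_le hW hgT.1 hu.nonneg hu1 hE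
  have hcW : Continuous fun t : ℝ => W (u t) :=
    hW.continuousOn.comp_continuous hP.continuous hP.nonneg
  have hcQ : Continuous fun t : ℝ => dQ W (u t) :=
    hW.continuousOn_dQ.comp_continuous hP.continuous hP.nonneg
  have hc1 : Continuous fun t : ℝ => dQ W (u t) + 3 * ε ^ 2 / 2 * torusDeriv u t ^ 2 :=
    hcQ.add (continuous_const.mul (hP.continuous_deriv.pow 2))
  have hc2 : Continuous fun t : ℝ => ε ^ 2 / 2 * torusDeriv u t ^ 2 + W (u t) :=
    (continuous_const.mul (hP.continuous_deriv.pow 2)).add hcW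
  have hB : ∫ t in (0 : ℝ)..1, (dQ W (u t) + 3 * ε ^ 2 / 2 * torusDeriv u t ^ 2) ≤
      c + (c + 3) * C := by
    -- The growth bound gives `dQ ≤ c (1 + W)`, and the gradient term is three times its share of
    -- the energy density; both fit under the factor `c + 3`.
    have h1 : ∫ t in (0 : ℝ)..1, (dQ W (u t) + 3 * ε ^ 2 / 2 * torusDeriv u t ^ 2) ≤
        ∫ t in (0 : ℝ)..1, (c + (c + 3) * (ε ^ 2 / 2 * torusDeriv u t ^ 2 + W (u t))) := by
      refine intervalIntegral.integral_mono_on zero_le_one (hc1.intervalIntegrable _ _)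
        ((continuous_const.add (continuous_const.mul hc2)).intervalIntegrable _ _) fun t _ => ?_
      have h2 := (abs_le.1 (hgrow _ (hu.nonneg t)).1).2
      have h3 := hW.nonneg _ (hu.nonneg t)
      have h4 : 0 ≤ c * (ε ^ 2 / 2 * torusDeriv u t ^ 2) := by positivity
      linarith
    rw [intervalIntegral.integral_add intervalIntegrable_const
      ((continuous_const.fun_mul hc2).intervalIntegrable _ _), intervalIntegral.integral_const,
      intervalIntegral.integral_const_mul, sub_zero, one_smul] at h1
    have h5 := mul_le_mul_of_nonneg_left hEint (by positivity : 0 ≤ c + 3)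
    linarith
  have hmass : ∫ t in (0 : ℝ)..1, u t = 1 := by
    rw [← integral_unitAddCircle u, hu.integral_eq_one]
  have hA : ∀ t ∈ Icc (0 : ℝ) 1, A t ≤ M := fun t ht =>
    hP.A_le_of_periodic hW hε (periodic_comp_coe u) hmass hB ht
  intro x
  obtain ⟨t, rfl⟩ := QuotientAddGroup.mk_surjective x
  exact hP.le_of_periodic hε (periodic_comp_coe u) hA (le_max_right _ _)
    (fun q hq => hR q ((le_max_left _ _).trans hq.le)) t

end CahnHilliard

end

theorem theorem4p1 (W : ℝ → ℝ) (hW : CahnHilliard.IsPotential W)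
    (C : NNReal) (η : ℝ) (hη : 0 < η) :
    ∃ δ : ℝ, 0 < δ ∧ ∀ L : ℝ, 0 ≤ L → ∃ ε₀ : ℝ, 0 < ε₀ ∧
      ∀ (I : Set ℝ) (ρ : ℝ → UnitAddCircle → ℝ), I ⊆ Set.Ioi 0 →
        (∀ ε ∈ I, CahnHilliard.IsProbDensity (ρ ε)) →
        (∀ ε ∈ I, CahnHilliard.TorusContDiff 1 (ρ ε)) →
        (⨆ ε ∈ I, (CahnHilliard.energy W ε (ρ ε) + CahnHilliard.slope W ε (ρ ε))) ≤ (C : ENNReal) →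
        ∀ ε ∈ I, ε < ε₀ → ∀ x y : ℝ, 0 < y - x → y - x < δ →
          |CahnHilliard.torusDeriv (ρ ε) (x : UnitAddCircle)| < L →
          |CahnHilliard.torusDeriv (ρ ε) (y : UnitAddCircle)| < L →
          (∀ z ∈ Set.Icc x y,
              Metric.infDist (ρ ε (z : UnitAddCircle)) (CahnHilliard.unstableSet W) < η) ∨
            |ρ ε (x : UnitAddCircle) - ρ ε (y : UnitAddCircle)| < η := by
  obtain ⟨R, hR⟩ := hW.exists_profile_bound C
  obtain ⟨δ, hδ, hmain⟩ := hW.exists_thresholds (R := R) hη (by positivity : (0 : ℝ) < C + 1)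
  refine ⟨δ, hδ, fun L hL => ?_⟩
  obtain ⟨ε₀, hε₀, hdich⟩ := hmain L hL
  refine ⟨ε₀, hε₀, fun I ρ hI hprob hC1 hsup ε hεI hlt x y hxy hyx hx hy => ?_⟩
  obtain ⟨hbound, A, g, hP⟩ := hR ε (ρ ε) (hI hεI) (hprob ε hεI) (hC1 ε hεI)
    ((le_iSup₂ (f := fun ε _ => CahnHilliard.energy W ε (ρ ε) + CahnHilliard.slope W ε (ρ ε))
      ε hεI).trans hsup)
  exact hdich ε _ _ A g (hI hεI) hlt hP (fun t => hbound t) x y hxy hyx hx hy
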